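/- Conventions. Let $X$ be a (Hausdorff) complex analytic space. Germs $(S,\circ)$ are germs of complex analytic spaces at a point, $\mathcal{O}_\circ(S)$ is the corresponding analytic $\mathbb{C}$-algebra and $\mathfrak{m}(S)$ its maximal ideal; a morphism of germs is an embedding if the homomorphism of analytic algebras is surjective, and a subgerm of $S$ is (given by) an embedding into $S$. A deformation of $X$ over a germ $(S,\circ)$ is a pair $(f,i)$, where $f:\mathcal{X}\to(S,\circ)$ is a flat morphism and $i:X\to f^{-1}(\circ)=\mathcal{X}\times_S\circ$ is an isomorphism of complex spaces; here $\mathcal{X}$ is taken as a germ along the fibre $f^{-1}(\circ)$. An isomorphism of deformations of $X$ over the same germ is an isomorphism of the total spaces over that germ which is compatible with the identifications of $X$ with the special fibres. A morphism of germs $h:R\to S$ induces a deformation $f\times_S h$ of $X$ over $R$ (fibre product); if $h$ is an embedding this is the restriction $f|R$. A deformation $f$ over $S$ is versal if every deformation of $X$ over any germ $R$ is isomorphic to $f\times_S h$ for some $h:R\to S$. Let $D$ be the category of germs $P$ with $\mathfrak{m}(P)^2=0$. A deformation $\delta$ over $T_X\in D$ is universal in $D$ if each deformation over $P\in D$ is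 isomorphic to $\delta\times h$ for a unique $h:P\to T_X$. Let $T(S)\subset S$ be the subgerm with algebra $\mathcal{O}_\circ(S)/\mathfrak{m}(S)^2$. A versal deformation $f$ is miniversal if $X$ has a universal deformation $\delta$ in $D$ and the Kodaira-Spencer mapping $D_\circ f:T(S)\to T_X$, defined by $f|T(S)\cong\delta\times D_\circ f$, is injective (as a linear map of tangent spaces). A subgerm $M\subset S$ is modular for $f$ if for any germ $R$ and any morphisms $h:R\to M$, $g:R\to S$ such that $f\times_S h\cong f\times_S g$ as deformations of $X$, one has $h=g$ (as morphisms to $S$). A modular subgerm is maximal if it contains any other modular subgerm. Proposition. Let $f:\mathcal{X}\to S$ and $f':\mathcal{X}'\to S'$ be miniversal deformations of the same space $X$, and suppose that $M\subset S$ and $M'\subset S'$ are their respective maximal modular strata. Then there exists an isomorphism of germs $h:M'\to M$ such that $f'|M'\cong (f|M)\times_M h$ as deformations of $X$. Moreover $h$ is the only morphism of germs $M'\to M$ with this property. -/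

import Mathlib

open CategoryTheory AlgebraicGeometry TopologicalSpace Opposite
open scoped Manifold ContDiff

noncomputable section

/-! ### Locally ringed spaces over the complex numbers -/

/-- A locally `ℂ`-ringed space: a locally ringed space whose structure sheaf is a sheaf of
`ℂ`-algebras (equivalently, whose ring of global sections is a `ℂ`-algebra). -/
structure CSpace where
  /-- the underlying locally ringed space -/
  space : LocallyRingedSpace.{0}
  /-- the constants, as global sections of the structure sheaf -/
  const : CommRingCat.of ℂ ⟶ LocallyRingedSpace.Γ.obj (op space)

namespace CSpace

/-- A morphism of locally `ℂ`-ringed spaces: a morphism of locally ringed spaces whose maps on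
sections are maps of `ℂ`-algebras. -/
@[ext]
structure Hom (X Y : CSpace) where
  /-- the underlying morphism of locally ringed spaces -/
  map : X.space ⟶ Y.space
  /-- compatibility with the constants -/
  const_comp : Y.const ≫ LocallyRingedSpace.Γ.map map.op = X.const

instance : Category CSpace where
  Hom := Hom
  id X := ⟨𝟙 _, by rw [op_id, CategoryTheory.Functor.map_id, Category.comp_id]⟩
  comp f g := ⟨f.map ≫ g.map, by
    rw [op_comp, CategoryTheory.Functor.map_comp, ← Category.assoc, g.const_comp, f.const_comp]⟩
  id_comp f := Hom.ext (Category.id_comp f.map)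
  comp_id f := Hom.ext (Category.comp_id f.map)
  assoc f g h := Hom.ext (Category.assoc f.map g.map h.map)

/-- The open subspace of a locally `ℂ`-ringed space on the open set `V`. -/
def restrict (X : CSpace) (V : Opens X.space.toTopCat) : CSpace where
  space := X.space.restrict V.isOpenEmbedding
  const := X.const ≫ LocallyRingedSpace.Γ.map (X.space.ofRestrict V.isOpenEmbedding).op

/-- The inclusion of an open subspace. -/
def ofRestrict (X : CSpace) (V : Opens X.space.toTopCat) : X.restrict V ⟶ X :=
  ⟨X.space.ofRestrict V.isOpenEmbedding, rfl⟩

/-- The map of underlying topological spaces of a morphism. -/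
def Hom.base {X Y : CSpace} (f : X ⟶ Y) : X.space.toTopCat → Y.space.toTopCat :=
  f.map.base

/-- The homomorphism of local rings induced by a morphism at a point. -/
def Hom.stalkMap {X Y : CSpace} (f : X ⟶ Y) (x : X.space.toTopCat) :
    Y.space.presheaf.stalk (Hom.base f x) →+* X.space.presheaf.stalk x :=
  (LocallyRingedSpace.Hom.stalkMap f.map x).hom

end CSpace

/-- The ring of holomorphic functions on an open subset of `ℂⁿ`. -/
abbrev HolomorphicOn {n : ℕ} (D : Opens (EuclideanSpace ℂ (Fin n))) : Type :=
  C^∞⟮𝓘(ℂ, EuclideanSpace ℂ (Fin n)), D; 𝓘(ℂ), ℂ⟯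

/-- `ℂⁿ` with its sheaf of holomorphic functions. (Over the field `ℂ`, the functions of class `C^∞`
are the holomorphic ones.) -/
def affineCSpace (n : ℕ) : CSpace where
  space := ChartedSpace.locallyRingedSpace 𝓘(ℂ, EuclideanSpace ℂ (Fin n)) (EuclideanSpace ℂ (Fin n))
  const := (CommRingCat.ofHom (algebraMap ℂ (HolomorphicOn ⊤)) :
    CommRingCat.of ℂ ⟶ CommRingCat.of (HolomorphicOn (⊤ : Opens (EuclideanSpace ℂ (Fin n)))))

/-- The germ of a holomorphic function at a point of its domain, as an element of the stalk
`𝒪_{ℂⁿ, z}`. -/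
def holomorphicGerm {n : ℕ} {D : Opens (EuclideanSpace ℂ (Fin n))} (F : HolomorphicOn D)
    (z : EuclideanSpace ℂ (Fin n)) (hz : z ∈ D) : (affineCSpace n).space.presheaf.stalk z :=
  (affineCSpace n).space.presheaf.germ (U := D) z hz F

/-! ### Complex analytic spaces and their germs -/

/-- A local presentation of the locally `ℂ`-ringed space `X` near the point `x`: an open
neighbourhood `V` of `x`, identified (by `j`) with the ringed space `(A, (𝒪_D / (F₁, …, F_r))|_A)`,
where `D ⊆ ℂⁿ` is open, `F₁, …, F_r` are holomorphic on `D`, and `A = j(V)` is a relatively closed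
subset of `D`. By surjectivity of the stalk maps, `A` is contained in the common zero
set of the `F_k`; if it is equal to it, this is the usual local model of a complex analytic space,
and otherwise it is the germ of that local model along `A`. -/
structure LocalPresentation (X : CSpace) (x : X.space.toTopCat) where
  /-- the neighbourhood of `x` -/
  V : Opens X.space.toTopCat
  mem : x ∈ V
  /-- the dimension of the ambient space -/
  n : ℕ
  /-- the open subset of `ℂⁿ` -/
  D : Opens (EuclideanSpace ℂ (Fin n))
  /-- the number of equations -/
  r : ℕ
  /-- the equations -/
  F : Fin r → HolomorphicOn D
  /-- the embedding -/
  j : X.restrict V ⟶ affineCSpace n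
  isEmbedding : Topology.IsEmbedding (CSpace.Hom.base j)
  mem_D : ∀ y, CSpace.Hom.base j y ∈ D
  closed : ∃ K : Set (EuclideanSpace ℂ (Fin n)), IsClosed K ∧
    Set.range (CSpace.Hom.base j) = K ∩ (D : Set (EuclideanSpace ℂ (Fin n)))
  surjective : ∀ y, Function.Surjective (CSpace.Hom.stalkMap j y)
  ker_eq : ∀ y, RingHom.ker (CSpace.Hom.stalkMap j y) =
    Ideal.span (Set.range fun k => holomorphicGerm (F k) (CSpace.Hom.base j y) (mem_D y))

/-- A complex analytic space: a Hausdorff locally `ℂ`-ringed space which is locally isomorphic to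
`(A, (𝒪_D / (F₁, …, F_r))|_A)`, with `A` the set of common zeros in the open set `D ⊆ ℂⁿ` of the
holomorphic functions `F₁, …, F_r`. -/
def IsComplexSpace (X : CSpace) : Prop :=
  T2Space X.space.toTopCat ∧ ∀ x : X.space.toTopCat, ∃ c : LocalPresentation X x,
    Set.range (CSpace.Hom.base c.j) =
      {z : EuclideanSpace ℂ (Fin c.n) | ∃ hz : z ∈ c.D, ∀ k, c.F k ⟨z, hz⟩ = 0}

/-- The locally `ℂ`-ringed spaces which have local presentations. These are, locally, the ringed
spaces `(A, 𝒪_Z|_A)` with `Z` a complex analytic space and `A` a closed subset of `Z`. Sections of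
`𝒪_Z|_A` are germs along `A` of sections of `𝒪_Z`, and morphisms of such ringed spaces are germs
along `A` of morphisms of complex spaces. -/
def isSpaceGerm : ObjectProperty CSpace :=
  fun X => ∀ x, Nonempty (LocalPresentation X x)

/-- The category of germs of complex analytic spaces along closed subsets. It contains the complex
analytic spaces (`A = Z`) and the germs of complex analytic spaces at a point (`A` a point). -/
abbrev SpaceGerm := isSpaceGerm.FullSubcategory

namespace SpaceGerm

/-- The set of points. -/
abbrev Pt (X : SpaceGerm) : Type := X.obj.space.toTopCat

/-- The stalk of the structure sheaf at a point. -/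
abbrev Stalk (X : SpaceGerm) (x : X.Pt) : Type := X.obj.space.presheaf.stalk x

/-- The map on points. -/
abbrev onPt {X Y : SpaceGerm} (f : X ⟶ Y) : X.Pt → Y.Pt := CSpace.Hom.base f.hom

/-- The map on stalks. -/
abbrev onStalk {X Y : SpaceGerm} (f : X ⟶ Y) (x : X.Pt) : Y.Stalk (onPt f x) →+* X.Stalk x :=
  CSpace.Hom.stalkMap f.hom x

end SpaceGerm

open SpaceGerm

/-- A germ `(S, ∘)` of a complex analytic space at a point, that is, the one-point space `∘` with
an analytic `ℂ`-algebra `𝒪_∘(S)` (a quotient of the ring of convergent power series in `n`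
variables by a finitely generated ideal). Morphisms of germs are the morphisms in `SpaceGerm`. -/
structure Germ where
  /-- the underlying object -/
  sp : SpaceGerm
  nonempty : Nonempty sp.Pt
  subsingleton : Subsingleton sp.Pt

theorem affine_stalkMap_bijective (n : ℕ) (y : ((affineCSpace n).restrict ⊤).space.toTopCat) :
    Function.Bijective (CSpace.Hom.stalkMap ((affineCSpace n).ofRestrict ⊤) y) := by
  have h : IsIso (LocallyRingedSpace.Hom.stalkMap ((affineCSpace n).space.ofRestrict
      (⊤ : Opens (affineCSpace n).space.toTopCat).isOpenEmbedding) y) := by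
    exact PresheafedSpace.ofRestrict_stalkMap_isIso _ _ _
  exact (ConcreteCategory.isIso_iff_bijective _).1 h

/-- A local presentation of `ℂⁿ` (with no equations). -/
def affinePresentation (n : ℕ) (x : (affineCSpace n).space.toTopCat) :
    LocalPresentation (affineCSpace n) x where
  V := ⊤
  mem := trivial
  n := n
  D := ⊤
  r := 0
  F := Fin.elim0
  j := (affineCSpace n).ofRestrict ⊤
  isEmbedding := (Opens.isOpenEmbedding (⊤ : Opens (affineCSpace n).space.toTopCat)).isEmbedding
  mem_D := fun _ => trivial
  closed := ⟨Set.univ, isClosed_univ, by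
    ext z
    constructor
    · intro _
      exact ⟨trivial, trivial⟩
    · intro _
      exact ⟨⟨z, trivial⟩, rfl⟩⟩
  surjective := fun y => (affine_stalkMap_bijective n y).2
  ker_eq := fun y => by
    rw [(RingHom.injective_iff_ker_eq_bot _).1 (affine_stalkMap_bijective n y).1]
    simp

/-- The simple point `∘`: the space `ℂ⁰`, with the algebra `ℂ`. -/
def simplePoint : Germ where
  sp := ⟨affineCSpace 0, fun x => ⟨affinePresentation 0 x⟩⟩
  nonempty := ⟨(0 : EuclideanSpace ℂ (Fin 0))⟩
  subsingleton := inferInstanceAs (Subsingleton (EuclideanSpace ℂ (Fin 0)))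

/-- A morphism of germs is an embedding if the homomorphism of analytic algebras is surjective. The
subgerms (strata) of a germ `S` are given by embeddings into `S`. -/
def IsGermEmbedding {Z S : Germ} (f : Z.sp ⟶ S.sp) : Prop :=
  ∀ z, Function.Surjective (onStalk f z)

/-! ### Deformations -/

/-- A deformation `(f, i)` of `X` over the germ `(S, ∘)`: a flat morphism `f : 𝒳 ⟶ (S, ∘)`,
with an isomorphism `i` of `X` onto the fibre `f⁻¹(∘) = 𝒳 ×_S ∘`, here written as a cartesian
square. The space `𝒳` is considered as a germ along `f⁻¹(∘)`, that is, up to shrinking to a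
neighbourhood of this fibre. -/
structure Deformation (X : SpaceGerm) (S : Germ) where
  /-- the total space -/
  total : SpaceGerm
  /-- the projection to the base -/
  f : total ⟶ S.sp
  flat : ∀ x, (onStalk f x).Flat
  /-- the embedding of `X` as the special fibre -/
  i : X ⟶ total
  isFiber : ∃ (q : X ⟶ simplePoint.sp) (p : simplePoint.sp ⟶ S.sp), IsPullback i q f p

/-- `IsInduced F h G` says that the deformation `G = (g, j)` of `X` over `R` is isomorphic, as a
deformation of `X`, to the deformation `F ×_S h` induced from `F = (f, i)` by the morphism
of germs `h : R ⟶ S`: there is a cartesian square over `h` which is compatible with `i` and `j`. -/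
def IsInduced {X : SpaceGerm} {S R : Germ} (F : Deformation X S) (h : R.sp ⟶ S.sp)
    (G : Deformation X R) : Prop :=
  ∃ H : G.total ⟶ F.total, IsPullback H G.f F.f h ∧ G.i ≫ H = F.i

/-- A versal deformation: any deformation of `X` is induced from it. -/
def IsVersal {X : SpaceGerm} {S : Germ} (F : Deformation X S) : Prop :=
  ∀ (R : Germ) (G : Deformation X R), ∃ h : R.sp ⟶ S.sp, IsInduced F h G

/-- The germs of the category `D`: those with algebra `ℂ ⊕ V` where `V² = 0`, that is, those whose
maximal ideal has square zero. (The maximal ideal `V` is then of finite dimension.) -/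
def IsFirstOrder (P : Germ) : Prop :=
  ∀ x : P.sp.Pt, IsLocalRing.maximalIdeal (P.sp.Stalk x) ^ 2 = ⊥

/-- A universal deformation of `X` in the category `D`. -/
def IsFirstOrderUniversal {X : SpaceGerm} {T : Germ} (δ : Deformation X T) : Prop :=
  IsFirstOrder T ∧ ∀ P : Germ, IsFirstOrder P → ∀ G : Deformation X P,
    ∃! h : P.sp ⟶ T.sp, IsInduced δ h G

/-- The embedding `t : T(S) ⟶ S` of the tangent space of the germ `S`: the subgerm with algebra
`𝒪(S) / 𝔪²`. -/
def IsTangentSpace {T S : Germ} (t : T.sp ⟶ S.sp) : Prop :=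
  IsGermEmbedding t ∧ ∀ x, RingHom.ker (onStalk t x) =
    IsLocalRing.maximalIdeal (S.sp.Stalk (onPt t x)) ^ 2

/-- `K : T(S) ⟶ T_X` is the Kodaira-Spencer mapping of `F`, with respect to the embedding
`t : T(S) ⟶ S` of the tangent space and the universal deformation `δ` of `X` in the category `D`:
the deformation induced from `δ` by `K` is the restriction of `F` to `T(S)`. -/
def IsKodairaSpencer {X : SpaceGerm} {S T TX : Germ} (F : Deformation X S) (t : T.sp ⟶ S.sp)
    (δ : Deformation X TX) (K : T.sp ⟶ TX.sp) : Prop :=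
  ∃ FT : Deformation X T, IsInduced F t FT ∧ IsInduced δ K FT

/-- A miniversal deformation: a versal deformation of a space `X` that has a universal deformation in
the category `D`, such that the Kodaira-Spencer mapping is injective. (A morphism in the
category `D` is injective as a linear map of tangent spaces if and only if the dual map of the
maximal ideals is surjective, that is, if and only if it is an embedding of germs.) -/
def IsMiniversal {X : SpaceGerm} {S : Germ} (F : Deformation X S) : Prop :=
  IsVersal F ∧ ∃ (T TX : Germ) (t : T.sp ⟶ S.sp) (δ : Deformation X TX) (K : T.sp ⟶ TX.sp),
    IsTangentSpace t ∧ IsFirstOrderUniversal δ ∧ IsKodairaSpencer F t δ K ∧ IsGermEmbedding K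

/-- The subgerm `ι : M ⟶ S` is modular for the deformation `F` over `S`: if morphisms of germs
`h : R ⟶ M` and `g : R ⟶ S` induce isomorphic deformations of `X` over `R`, then `h = g`. -/
def IsModular {X : SpaceGerm} {S M : Germ} (F : Deformation X S) (ι : M.sp ⟶ S.sp) : Prop :=
  IsGermEmbedding ι ∧ ∀ (R : Germ) (h : R.sp ⟶ M.sp) (g : R.sp ⟶ S.sp) (G : Deformation X R),
    IsInduced F (h ≫ ι) G → IsInduced F g G → h ≫ ι = g

/-- A maximal modular stratum: a modular subgerm that contains any other modular subgerm. -/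
def IsMaximalModular {X : SpaceGerm} {S M : Germ} (F : Deformation X S) (ι : M.sp ⟶ S.sp) : Prop :=
  IsModular F ι ∧ ∀ (N : Germ) (κ : N.sp ⟶ S.sp), IsModular F κ →
    ∃ u : N.sp ⟶ M.sp, u ≫ ι = κ

end

/-! By versality there are morphisms `a : S ⟶ S'` and `b : S' ⟶ S` inducing `f` from `f'` and `f'`
from `f`. They need not be inverse to each other, but `a ≫ b` induces `f` from itself, so modularity
of `M` forces `ι ≫ a ≫ b = ι`. The composite `ι ≫ a` is then again an embedding, and the point is
that it is modular for `f'`. Maximality of `M'` then gives a map `u : M ⟶ M'`, and symmetrically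
there is `v : M' ⟶ M`. Since embeddings are monomorphisms, `u` and `v` are mutually inverse; the
uniqueness of `v` is modularity of `M` once more (`exists_map_of_modular`).

Modularity of `ι ≫ a` comes down to cancelling `b ≫ a`, an endomorphism `φ` of `S'` inducing `f'`
from itself. It respects the Kodaira-Spencer mapping, by uniqueness in the universal property over
`D`; this mapping is an embedding, so `φ` is the identity on the tangent space. Two morphisms to
`S'` that agree after `φ` then differ by elements of every power of the maximal ideal, hence are
equal by Krull's intersection theorem (`IsMiniversal.eq_of_comp_eq`, `eq_of_comp_eq_of_sub_mem_sq`).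

Krull's theorem needs analytic algebras to be Noetherian. They are quotients of stalks of the sheaf
of holomorphic functions on `ℂⁿ`. Such a stalk is an image of the ring of convergent power series
(`sumGerm_surjective`, by Cauchy's estimates and Taylor expansion), which is Noetherian by division
with remainder in weighted `ℓ¹`-norms (`exists_division`) and Dickson's lemma. -/

/-! ### Convergent power series -/

namespace ConvergentSeries

open MvPowerSeries
open scoped ENNReal

variable {n : ℕ}

/-- The integer `∏ pᵢ ^ αᵢ`, where `pᵢ` is the `i`-th prime number. It gives a total order on the
monomials in which every monomial has finitely many predecessors. -/
noncomputable def index (α : Fin n →₀ ℕ) : ℕ := α.prod fun i k => Nat.nth Nat.Prime i ^ k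

theorem prime_nth (i : ℕ) : (Nat.nth Nat.Prime i).Prime := Nat.prime_nth_prime i

theorem index_add (α β : Fin n →₀ ℕ) : index (α + β) = index α * index β :=
  Finsupp.prod_add_index' (fun _ => pow_zero _) fun _ _ _ => pow_add _ _ _

theorem index_zero : index (0 : Fin n →₀ ℕ) = 1 := Finsupp.prod_zero_index

theorem index_pos (α : Fin n →₀ ℕ) : 0 < index α :=
  Finset.prod_pos fun i _ => pow_pos (prime_nth i).pos _

/-- Unique factorization: the exponents can be read off from the prime factorization of the index.
-/
theorem index_injective : Function.Injective (index (n := n)) := by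
  have hinj : Function.Injective fun i : Fin n => Nat.nth Nat.Prime i :=
    (Nat.nth_injective Nat.infinite_setOfPred_prime).comp Fin.val_injective
  have key : ∀ α : Fin n →₀ ℕ, (index α).factorization =
      α.mapDomain fun i : Fin n => Nat.nth Nat.Prime i := by
    intro α
    rw [← Nat.prod_pow_factorization_eq_self
      (f := α.mapDomain fun i : Fin n => Nat.nth Nat.Prime i)]
    · rw [index, Finsupp.prod_mapDomain_index_inj hinj]
    · intro q hq
      obtain ⟨i, _, rfl⟩ := Finset.mem_image.1 (Finsupp.mapDomain_support hq)
      exact prime_nth i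
  intro α β h
  apply Finsupp.mapDomain_injective hinj
  rw [← key, ← key, h]

/-- The weight `N(α)⁻ˢ` of the monomial `α` in the `s`-th norm. -/
noncomputable def weight (s : ℕ) (α : Fin n →₀ ℕ) : ℝ≥0∞ := ((index α : ℝ≥0∞)⁻¹) ^ s

theorem weight_add (s : ℕ) (α β : Fin n →₀ ℕ) :
    weight s (α + β) = weight s α * weight s β := by
  rw [weight, weight, weight, ← mul_pow, index_add, Nat.cast_mul, ENNReal.mul_inv] <;> simp

theorem weight_zero (s : ℕ) : weight s (0 : Fin n →₀ ℕ) = 1 := by simp [weight, index_zero]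

theorem weight_ne_top (s : ℕ) (α : Fin n →₀ ℕ) : weight s α ≠ ⊤ := by
  have := (index_pos α).ne'
  simp [weight, this]

theorem weight_ne_zero (s : ℕ) (α : Fin n →₀ ℕ) : weight s α ≠ 0 := by
  simp [weight]

theorem weight_anti (α : Fin n →₀ ℕ) {s t : ℕ} (h : s ≤ t) : weight t α ≤ weight s α := by
  refine pow_le_pow_of_le_one zero_le ?_ h
  rw [ENNReal.inv_le_one]
  exact_mod_cast index_pos α

/-- The weighted `ℓ¹`-norms of a power series. -/
noncomputable def wnorm (s : ℕ) (f : MvPowerSeries (Fin n) ℂ) : ℝ≥0∞ :=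
  ∑' α, ‖coeff α f‖ₑ * weight s α

theorem wnorm_zero (s : ℕ) : wnorm s (0 : MvPowerSeries (Fin n) ℂ) = 0 := by simp [wnorm]

theorem wnorm_neg (s : ℕ) (f : MvPowerSeries (Fin n) ℂ) : wnorm s (-f) = wnorm s f := by
  simp [wnorm]

theorem wnorm_add_le (s : ℕ) (f g : MvPowerSeries (Fin n) ℂ) :
    wnorm s (f + g) ≤ wnorm s f + wnorm s g := by
  rw [wnorm, wnorm, wnorm, ← ENNReal.tsum_add]
  refine ENNReal.tsum_le_tsum fun α => ?_
  rw [map_add, ← add_mul]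
  gcongr
  exact enorm_add_le _ _

theorem wnorm_sum_le {κ : Type*} (s : ℕ) (t : Finset κ) (f : κ → MvPowerSeries (Fin n) ℂ) :
    wnorm s (∑ i ∈ t, f i) ≤ ∑ i ∈ t, wnorm s (f i) :=
  Finset.le_sum_of_subadditive _ (wnorm_zero s).le (wnorm_add_le s) _ _

theorem wnorm_anti (f : MvPowerSeries (Fin n) ℂ) {s t : ℕ} (h : s ≤ t) :
    wnorm t f ≤ wnorm s f :=
  ENNReal.tsum_le_tsum fun α => mul_le_mul_right (weight_anti α h) _

/-- The index, hence the weight, is multiplicative, so the terms of the Cauchy product are dominated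
by those of the product of the two norms. -/
theorem wnorm_mul_le (s : ℕ) (f g : MvPowerSeries (Fin n) ℂ) :
    wnorm s (f * g) ≤ wnorm s f * wnorm s g := by
  classical
  calc wnorm s (f * g)
      ≤ ∑' α, ∑ x ∈ Finset.HasAntidiagonal.antidiagonal α,
          (‖coeff x.1 f‖ₑ * weight s x.1) * (‖coeff x.2 g‖ₑ * weight s x.2) := by
        refine ENNReal.tsum_le_tsum fun α => ?_
        rw [coeff_mul]
        refine (mul_le_mul_left (enorm_sum_le _ _) _).trans ?_
        rw [Finset.sum_mul]
        refine Finset.sum_le_sum fun x hx => ?_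
        rw [← Finset.HasAntidiagonal.mem_antidiagonal.1 hx, weight_add, enorm_mul]
        exact le_of_eq (by ring)
    _ = ∑' x : (Fin n →₀ ℕ) × (Fin n →₀ ℕ),
          (‖coeff x.1 f‖ₑ * weight s x.1) * (‖coeff x.2 g‖ₑ * weight s x.2) := by
        rw [← Finset.HasAntidiagonal.sigmaAntidiagonalEquivProd.tsum_eq, ENNReal.tsum_sigma']
        refine tsum_congr fun α => ?_
        rw [tsum_fintype, ← Finset.sum_coe_sort]
        rfl
    _ = wnorm s f * wnorm s g := by
        rw [ENNReal.tsum_prod']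
        simp_rw [ENNReal.tsum_mul_left, ENNReal.tsum_mul_right]
        rfl

theorem wnorm_C (s : ℕ) (c : ℂ) : wnorm s (C c : MvPowerSeries (Fin n) ℂ) = ‖c‖ₑ := by
  classical
  rw [wnorm, tsum_eq_single 0]
  · simp [weight_zero]
  · intro α hα
    simp [coeff_C, hα]

/-- A lower bound for the terms gives a decay of the weighted norms. -/
theorem exists_wnorm_mul_le {G : MvPowerSeries (Fin n) ℂ} {s₀ : ℕ} (hG : wnorm s₀ G ≠ ⊤)
    (e : Fin n →₀ ℕ) (he : ∀ α, coeff α G ≠ 0 → index e < index α) :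
    ∃ s₁, ∀ s, s₁ ≤ s → wnorm s G ≤ 2⁻¹ * weight s e := by
  set a : ℝ≥0∞ := (index e : ℝ≥0∞) with ha
  have ha0 : a ≠ 0 := by simpa [ha] using (index_pos e).ne'
  have hat : a ≠ ⊤ := by simp [ha]
  -- Every exponent of `G` has index at least `a + 1`, so each increment of `s` shrinks the norm by
  -- `(a + 1)⁻¹`, whereas the weight of `e` only shrinks by `a⁻¹`.
  have hr : (a + 1)⁻¹ * a < 1 := by
    rw [mul_comm, ← div_eq_mul_inv]
    apply ENNReal.div_lt_of_lt_mul
    rw [one_mul]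
    exact ENNReal.lt_add_right hat one_ne_zero
  have hlim : Filter.Tendsto (fun k : ℕ => wnorm s₀ G * a ^ s₀ * ((a + 1)⁻¹ * a) ^ k)
      Filter.atTop (nhds 0) := by
    rw [← mul_zero (wnorm s₀ G * a ^ s₀)]
    refine ENNReal.Tendsto.const_mul (ENNReal.tendsto_pow_atTop_nhds_zero_of_lt_one hr) (Or.inr ?_)
    exact ENNReal.mul_ne_top hG (ENNReal.pow_ne_top hat)
  obtain ⟨k₁, hk₁⟩ := Filter.eventually_atTop.1
    (hlim.eventually_le_const (u := 2⁻¹) (by simp))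
  refine ⟨s₀ + k₁, fun s hs => ?_⟩
  obtain ⟨k, rfl⟩ := Nat.exists_eq_add_of_le ((Nat.le_add_right _ _).trans hs)
  have hk := hk₁ k (by omega)
  have h1 : wnorm (s₀ + k) G ≤ wnorm s₀ G * ((a + 1)⁻¹) ^ k := by
    rw [wnorm, wnorm, ← ENNReal.tsum_mul_right]
    refine ENNReal.tsum_le_tsum fun α => ?_
    by_cases h0 : coeff α G = 0
    · simp [h0]
    rw [weight, pow_add, weight, ← mul_assoc]
    gcongr
    rw [ha]
    exact_mod_cast he α h0
  have h2 : weight (s₀ + k) e * (a ^ s₀ * a ^ k) = 1 := by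
    rw [weight, ← pow_add, ← mul_pow, ENNReal.inv_mul_cancel ha0 hat, one_pow]
  calc wnorm (s₀ + k) G ≤ (wnorm s₀ G * ((a + 1)⁻¹) ^ k) *
        (weight (s₀ + k) e * (a ^ s₀ * a ^ k)) := by rw [h2, mul_one]; exact h1
    _ = (wnorm s₀ G * a ^ s₀ * ((a + 1)⁻¹ * a) ^ k) * weight (s₀ + k) e := by
        rw [mul_pow]; ring
    _ ≤ _ := by gcongr

variable (n) in
/-- The ring of convergent power series in `n` variables. -/
def convergentSeries : Subring (MvPowerSeries (Fin n) ℂ) where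
  -- The `s`-th norm sums the absolute values of the terms at the point with coordinates `pᵢ⁻ˢ`.
  -- These points tend to `0`, so finiteness for some `s` is convergence near `0`.
  carrier := {f | ∃ s, wnorm s f ≠ ⊤}
  mul_mem' := by
    rintro f g ⟨s, hs⟩ ⟨t, ht⟩
    refine ⟨max s t, ne_top_of_le_ne_top (ENNReal.mul_ne_top ?_ ?_) (wnorm_mul_le _ f g)⟩
    · exact ne_top_of_le_ne_top hs (wnorm_anti f (le_max_left _ _))
    · exact ne_top_of_le_ne_top ht (wnorm_anti g (le_max_right _ _))
  one_mem' := ⟨0, by rw [← map_one (C (σ := Fin n) (R := ℂ)), wnorm_C]; simp⟩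
  add_mem' := by
    rintro f g ⟨s, hs⟩ ⟨t, ht⟩
    refine ⟨max s t, ne_top_of_le_ne_top (ENNReal.add_ne_top.2 ⟨?_, ?_⟩) (wnorm_add_le _ f g)⟩
    · exact ne_top_of_le_ne_top hs (wnorm_anti f (le_max_left _ _))
    · exact ne_top_of_le_ne_top ht (wnorm_anti g (le_max_right _ _))
  zero_mem' := ⟨0, by simp [wnorm_zero]⟩
  neg_mem' := by
    rintro f ⟨s, hs⟩
    exact ⟨s, by rwa [wnorm_neg]⟩

theorem C_mem_convergentSeries (c : ℂ) : C c ∈ convergentSeries n := ⟨0, by simp [wnorm_C]⟩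

/-- If the operator `T` on power series raises the index and halves a weighted norm, then `1 - T`
is surjective on the power series for which this norm is finite. -/
theorem exists_sub_map_eq (T : MvPowerSeries (Fin n) ℂ →ₗ[ℂ] MvPowerSeries (Fin n) ℂ)
    (hT : ∀ (K : ℕ) (g : MvPowerSeries (Fin n) ℂ), (∀ β, index β ≤ K → coeff β g = 0) →
      ∀ α, index α ≤ K + 1 → coeff α (T g) = 0)
    {s : ℕ} (hs : ∀ g, wnorm s (T g) ≤ 2⁻¹ * wnorm s g) (f : MvPowerSeries (Fin n) ℂ)
    (hf : wnorm s f ≠ ⊤) : ∃ g, g - T g = f ∧ wnorm s g ≠ ⊤ := by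
  -- Indices are at least `1`, so for `k = 0` there is nothing to prove.
  have hpow : ∀ k α, index α ≤ k → coeff α ((T ^ k) f) = 0 := by
    intro k
    induction k with
    | zero => intro α hα; exact absurd hα (index_pos α).not_ge
    | succ k ih => intro α hα; rw [pow_succ', Module.End.mul_apply]; exact hT k _ ih α hα
  have hnorm : ∀ k, wnorm s ((T ^ k) f) ≤ 2⁻¹ ^ k * wnorm s f := by
    intro k
    induction k with
    | zero => simp
    | succ k ih =>
      rw [pow_succ', Module.End.mul_apply, pow_succ', mul_assoc]
      exact (hs _).trans (mul_le_mul_right ih _)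
  -- The Neumann series `∑ T ^ k f`, taken coefficientwise: by `hpow` only the `k` below the index
  -- of `α` contribute.
  let g : MvPowerSeries (Fin n) ℂ := fun α => ∑ k ∈ Finset.range (index α), coeff α ((T ^ k) f)
  have hgc : ∀ α, coeff α g = ∑ k ∈ Finset.range (index α), coeff α ((T ^ k) f) := fun _ => rfl
  refine ⟨g, ?_, ?_⟩
  · ext α
    set K := index α with hK
    -- A partial sum agrees with `g` up to index `K` and satisfies the telescoped equation.
    let p := ∑ k ∈ Finset.range K, (T ^ k) f
    have hp : p - T p = f - (T ^ K) f := by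
      have hTp : T p = ∑ k ∈ Finset.range K, (T ^ (k + 1)) f := by
        simp only [p, map_sum, pow_succ', Module.End.mul_apply]
      rw [hTp, ← Finset.sum_sub_distrib]
      have := Finset.sum_range_sub' (fun k => (T ^ k) f) K
      simpa using this
    have hgp : ∀ β, index β ≤ K → coeff β (g - p) = 0 := by
      intro β hβ
      rw [map_sub, hgc, map_sum, sub_eq_zero]
      refine Finset.sum_subset (Finset.range_mono hβ) fun k _ hk => hpow k β ?_
      simpa using hk
    have h1 := hgp α le_rfl
    have h2 := hT K _ hgp α (by omega)
    have h3 := hpow K α le_rfl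
    have h4 := congrArg (coeff α) hp
    simp only [map_sub] at h1 h2 h4 ⊢
    linear_combination h1 - h2 + h4 - h3
  · have : wnorm s g ≤ ∑' k, wnorm s ((T ^ k) f) := by
      calc wnorm s g ≤ ∑' α, ∑' k, ‖coeff α ((T ^ k) f)‖ₑ * weight s α := by
            refine ENNReal.tsum_le_tsum fun α => ?_
            rw [hgc, ENNReal.tsum_mul_right]
            gcongr
            exact (enorm_sum_le _ _).trans (ENNReal.sum_le_tsum _)
        _ = _ := ENNReal.tsum_comm
    refine ne_top_of_le_ne_top ?_ (this.trans (ENNReal.tsum_le_tsum hnorm))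
    rw [ENNReal.tsum_mul_right, ENNReal.tsum_geometric]
    refine ENNReal.mul_ne_top ?_ hf
    simp

end ConvergentSeries

/-! ### Division with remainder and Rückert's basis theorem -/

namespace ConvergentSeries

open MvPowerSeries
open scoped ENNReal

variable {n : ℕ}

/-- The smallest exponent of a nonzero power series. -/
theorem exists_leading (f : MvPowerSeries (Fin n) ℂ) (hf : f ≠ 0) :
    ∃ e, coeff e f ≠ 0 ∧ ∀ α, coeff α f ≠ 0 → index e ≤ index α := by
  have hne : {e | coeff e f ≠ 0}.Nonempty := by
    by_contra h
    rw [Set.not_nonempty_iff_eq_empty, Set.eq_empty_iff_forall_notMem] at h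
    exact hf (MvPowerSeries.ext fun α => by simpa using h α)
  obtain ⟨e, he, hmin⟩ := WellFounded.has_min (measure (index (n := n))).wf _ hne
  exact ⟨e, he, fun α hα => not_lt.1 (hmin α hα)⟩

section Division

variable (E : Finset (Fin n →₀ ℕ))

open Classical in
/-- An element of `E` below `α`, if there is one. -/
noncomputable def divisor (α : Fin n →₀ ℕ) : Option (Fin n →₀ ℕ) :=
  if h : ∃ e ∈ E, e ≤ α then some h.choose else none

variable {E}

theorem mem_of_divisor_eq {α e : Fin n →₀ ℕ} (h : divisor E α = some e) : e ∈ E ∧ e ≤ α := by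
  unfold divisor at h
  split_ifs at h with h'
  rw [← Option.some.inj h]
  exact h'.choose_spec

theorem divisor_ne_none {α e : Fin n →₀ ℕ} (he : e ∈ E) (h : e ≤ α) : divisor E α ≠ none := by
  unfold divisor
  rw [dif_pos ⟨e, he, h⟩]
  exact Option.some_ne_none _

variable (E)

open Classical in
/-- The quotient by the monomial `e` of the part of a power series assigned to `e`. -/
noncomputable def quotientPart (e : Fin n →₀ ℕ) :
    MvPowerSeries (Fin n) ℂ →ₗ[ℂ] MvPowerSeries (Fin n) ℂ where
  toFun g := fun β => if divisor E (β + e) = some e then coeff (β + e) g else 0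
  map_add' g h := by
    funext β
    change (if divisor E (β + e) = some e then coeff (β + e) (g + h) else 0) =
      (if divisor E (β + e) = some e then coeff (β + e) g else 0) + if divisor E (β + e) = some e then coeff (β + e) h else 0
    split_ifs <;> simp
  map_smul' c g := by
    funext β
    change (if divisor E (β + e) = some e then coeff (β + e) (c • g) else 0) =
      c * if divisor E (β + e) = some e then coeff (β + e) g else 0
    split_ifs <;> simp

open Classical in
theorem coeff_quotientPart (e : Fin n →₀ ℕ) (g : MvPowerSeries (Fin n) ℂ) (β : Fin n →₀ ℕ) :
    coeff β (quotientPart E e g) =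
      if divisor E (β + e) = some e then coeff (β + e) g else 0 := rfl

open Classical in
/-- The part of a power series without multiples of the monomials in `E`. -/
noncomputable def remainderPart : MvPowerSeries (Fin n) ℂ →ₗ[ℂ] MvPowerSeries (Fin n) ℂ where
  toFun g := fun α => if divisor E α = none then coeff α g else 0
  map_add' g h := by
    funext β
    change (if divisor E β = none then coeff β (g + h) else 0) =
      (if divisor E β = none then coeff β g else 0) + if divisor E β = none then coeff β h else 0
    split_ifs <;> simp
  map_smul' c g := by
    funext β
    change (if divisor E β = none then coeff β (c • g) else 0) =
      c * if divisor E β = none then coeff β g else 0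
    split_ifs <;> simp

open Classical in
theorem coeff_remainderPart (g : MvPowerSeries (Fin n) ℂ) (α : Fin n →₀ ℕ) :
    coeff α (remainderPart E g) = if divisor E α = none then coeff α g else 0 := rfl

open Classical in
theorem coeff_monomial_mul_quotientPart (e : Fin n →₀ ℕ) (g : MvPowerSeries (Fin n) ℂ)
    (α : Fin n →₀ ℕ) : coeff α (monomial e 1 * quotientPart E e g) =
      if divisor E α = some e then coeff α g else 0 := by
  rw [coeff_monomial_mul]
  by_cases h : e ≤ α
  · rw [if_pos h, one_mul, coeff_quotientPart, tsub_add_cancel_of_le h]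
  · rw [if_neg h, if_neg fun h' => h (mem_of_divisor_eq h').2]

theorem sum_quotientPart_add_remainderPart (g : MvPowerSeries (Fin n) ℂ) :
    ∑ e ∈ E, monomial e 1 * quotientPart E e g + remainderPart E g = g := by
  classical
  ext α
  rw [map_add, map_sum, coeff_remainderPart]
  simp_rw [coeff_monomial_mul_quotientPart]
  cases h : divisor E α with
  | none => simp
  | some e => simp [(mem_of_divisor_eq h).1]

/-- Each exponent is assigned to at most one element of `E`, so the parts of `g` have disjoint
supports; multiplicativity of the weight accounts for the shift by `e`. -/
theorem wnorm_quotientPart (s : ℕ) (g : MvPowerSeries (Fin n) ℂ) :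
    ∑ e ∈ E, weight s e * wnorm s (quotientPart E e g) ≤ wnorm s g := by
  classical
  have h1 : ∀ e, weight s e * wnorm s (quotientPart E e g) ≤
      ∑' α, if divisor E α = some e then ‖coeff α g‖ₑ * weight s α else 0 := by
    intro e
    rw [wnorm, ← ENNReal.tsum_mul_left]
    refine le_trans (le_of_eq (tsum_congr fun β => ?_)) (ENNReal.tsum_comp_le_tsum_of_injective
      (add_left_injective e) fun α =>
        if divisor E α = some e then ‖coeff α g‖ₑ * weight s α else 0)
    rw [coeff_quotientPart]
    split_ifs
    · rw [weight_add]; ring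
    · simp
  refine (Finset.sum_le_sum fun e _ => h1 e).trans ?_
  rw [← Summable.tsum_finsetSum fun _ _ => ENNReal.summable]
  refine ENNReal.tsum_le_tsum fun α => ?_
  cases h : divisor E α with
  | none => simp
  | some e => simp [(mem_of_divisor_eq h).1]

theorem wnorm_quotientPart_ne_top (s : ℕ) {g : MvPowerSeries (Fin n) ℂ} (hg : wnorm s g ≠ ⊤)
    {e : Fin n →₀ ℕ} (he : e ∈ E) : wnorm s (quotientPart E e g) ≠ ⊤ := by
  intro h
  have h1 := (Finset.single_le_sum (f := fun e => weight s e * wnorm s (quotientPart E e g))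
    (fun _ _ => zero_le) he).trans (wnorm_quotientPart E s g)
  rw [h, ENNReal.mul_top (weight_ne_zero s e), top_le_iff] at h1
  exact hg h1

/-- Division with remainder by finitely many convergent power series. -/
theorem exists_division (F : (Fin n →₀ ℕ) → MvPowerSeries (Fin n) ℂ)
    (hF : ∀ e ∈ E, F e ∈ convergentSeries n) (hF1 : ∀ e ∈ E, coeff e (F e) = 1)
    (hFe : ∀ e ∈ E, ∀ α, coeff α (F e) ≠ 0 → index e ≤ index α)
    {f : MvPowerSeries (Fin n) ℂ} (hf : f ∈ convergentSeries n) :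
    ∃ q : (Fin n →₀ ℕ) → MvPowerSeries (Fin n) ℂ, (∀ e ∈ E, q e ∈ convergentSeries n) ∧
      ∀ α, coeff α (f - ∑ e ∈ E, F e * q e) ≠ 0 → ∀ e ∈ E, ¬ e ≤ α := by
  classical
  have hG : ∀ e ∈ E, ∀ α, coeff α (F e - monomial e 1) ≠ 0 → index e < index α := by
    intro e he α hα
    rw [map_sub, coeff_monomial] at hα
    split_ifs at hα with h
    · subst h
      simp [hF1 _ he] at hα
    · rw [sub_zero] at hα
      exact lt_of_le_of_ne (hFe e he α hα) fun h' => h (index_injective h').symm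
  have hbound : ∀ e ∈ E, ∃ s₁, ∀ s, s₁ ≤ s →
      wnorm s (F e - monomial e 1) ≤ 2⁻¹ * weight s e := by
    intro e he
    obtain ⟨s₀, hs₀⟩ := hF e he
    refine exists_wnorm_mul_le (s₀ := s₀) ?_ e (hG e he)
    rw [sub_eq_add_neg]
    refine ne_top_of_le_ne_top (ENNReal.add_ne_top.2 ⟨hs₀, ?_⟩) (wnorm_add_le _ _ _)
    rw [wnorm_neg, wnorm, tsum_eq_single e]
    · exact ENNReal.mul_ne_top (by simp) (weight_ne_top _ _)
    · intro α hα
      simp [coeff_monomial, hα]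
  choose! s₁ hs₁ using hbound
  obtain ⟨s₂, hs₂⟩ := hf
  -- Large enough for `f` to have finite norm and for all the tails `F e - x ^ e` to be small.
  set s := max s₂ (E.sup s₁) with hs
  -- Dividing by the monomials `x ^ e` is exact and `-T` is the error from replacing them by `F e`;
  -- solving `g - T g = f` therefore divides `f` by the `F e`.
  let T : MvPowerSeries (Fin n) ℂ →ₗ[ℂ] MvPowerSeries (Fin n) ℂ :=
    -∑ e ∈ E, LinearMap.mulLeft ℂ (F e - monomial e 1) ∘ₗ quotientPart E e
  have hTapp : ∀ g, T g = -∑ e ∈ E, (F e - monomial e 1) * quotientPart E e g := by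
    intro g
    simp [T]
  have hsub : ∀ g, g - T g = ∑ e ∈ E, F e * quotientPart E e g + remainderPart E g := by
    intro g
    conv_lhs => enter [1]; rw [← sum_quotientPart_add_remainderPart E g]
    rw [hTapp, sub_neg_eq_add]
    simp_rw [sub_mul]
    rw [Finset.sum_sub_distrib]
    abel
  have hord : ∀ (K : ℕ) (g : MvPowerSeries (Fin n) ℂ), (∀ β, index β ≤ K → coeff β g = 0) →
      ∀ α, index α ≤ K + 1 → coeff α (T g) = 0 := by
    intro K g hg α hα
    rw [hTapp, map_neg, map_sum, neg_eq_zero]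
    refine Finset.sum_eq_zero fun e he => ?_
    rw [coeff_mul]
    refine Finset.sum_eq_zero fun x hx => ?_
    by_contra hne
    have h1 := hG e he x.1 (left_ne_zero_of_mul hne)
    have h2 := right_ne_zero_of_mul hne
    rw [coeff_quotientPart] at h2
    have h3 : K < index (x.2 + e) := by
      by_contra hle
      rw [hg _ (not_lt.1 hle)] at h2
      simp at h2
    rw [← Finset.HasAntidiagonal.mem_antidiagonal.1 hx, index_add] at hα
    rw [index_add] at h3
    have := index_pos x.2
    nlinarith
  have hhalf : ∀ g, wnorm s (T g) ≤ 2⁻¹ * wnorm s g := by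
    intro g
    rw [hTapp, wnorm_neg]
    refine (wnorm_sum_le s E _).trans ?_
    refine le_trans (Finset.sum_le_sum fun e he => ?_)
      (le_trans (Finset.mul_sum E _ _).ge (mul_le_mul_right (wnorm_quotientPart E s g) 2⁻¹))
    refine (wnorm_mul_le s _ _).trans ?_
    rw [← mul_assoc]
    gcongr
    exact hs₁ e he s ((Finset.le_sup he).trans (le_max_right _ _))
  obtain ⟨g, hg, hgn⟩ := exists_sub_map_eq T hord hhalf f
    (ne_top_of_le_ne_top hs₂ (wnorm_anti f (le_max_left _ _)))
  refine ⟨fun e => quotientPart E e g, fun e he =>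
    ⟨s, wnorm_quotientPart_ne_top E s hgn he⟩, fun α hα e he h => hα ?_⟩
  have : f - ∑ e ∈ E, F e * quotientPart E e g = remainderPart E g := by
    rw [← hg, hsub]; abel
  rw [this, coeff_remainderPart, if_neg (divisor_ne_none he h)]

end Division

/-- Rückert's basis theorem: the ring of convergent power series is Noetherian. -/
instance isNoetherianRing_convergentSeries : IsNoetherianRing (convergentSeries n) := by
  classical
  refine (isNoetherianRing_iff_ideal_fg _).2 fun I => ?_
  -- The exponents of the normalised leading terms, as for standard bases; leading means of smallest
  -- index.
  let L : Set (Fin n →₀ ℕ) := {e | ∃ f ∈ I, coeff e f.1 = 1 ∧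
    ∀ α, coeff α f.1 ≠ 0 → index e ≤ index α}
  have hL : ∀ f ∈ I, f ≠ 0 → ∃ e ∈ L, coeff e f.1 ≠ 0 := by
    intro f hf hf0
    obtain ⟨e, he, hmin⟩ := exists_leading f.1 fun h => hf0 (Subtype.ext h)
    refine ⟨e, ⟨⟨_, C_mem_convergentSeries (coeff e f.1)⁻¹⟩ * f, I.smul_mem _ hf, ?_, ?_⟩, he⟩
    · simp [he]
    · intro α hα
      refine hmin α fun h => hα ?_
      simp [h]
  -- Dickson's lemma.
  have hfin : {e | Minimal (· ∈ L) e}.Finite :=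
    WellQuasiOrderedLE.finite_of_isAntichain (setOfPred_minimal_antichain _)
  choose! F hFI hF1 hFe using fun e (he : e ∈ L) => he
  have hmem : ∀ e ∈ hfin.toFinset, e ∈ L := fun e he => (hfin.mem_toFinset.1 he).prop
  refine ⟨hfin.toFinset.image F, le_antisymm ?_ ?_⟩
  · rw [Submodule.span_le]
    intro x hx
    obtain ⟨e, he, rfl⟩ := Finset.mem_image.1 (Finset.mem_coe.1 hx)
    exact hFI e (hmem e he)
  · intro f hf
    obtain ⟨q, hq, hr⟩ := exists_division hfin.toFinset (fun e => (F e).1)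
      (fun e _ => (F e).2) (fun e he => hF1 e (hmem e he)) (fun e he => hFe e (hmem e he)) f.2
    choose! Q hQ using fun e (he : e ∈ hfin.toFinset) =>
      (⟨⟨q e, hq e he⟩, rfl⟩ : ∃ Q : convergentSeries n, Q.1 = q e)
    have hsum : ∑ e ∈ hfin.toFinset, F e * Q e ∈
        Submodule.span (convergentSeries n) (hfin.toFinset.image F : Set (convergentSeries n)) := by
      refine Submodule.sum_mem _ fun e he => ?_
      rw [mul_comm]
      exact Submodule.smul_mem _ _ (Submodule.subset_span
        (Finset.mem_coe.2 (Finset.mem_image_of_mem F he)))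
    -- A nonzero remainder would lie in `I`, so its leading exponent would be above a minimal
    -- element of `L`, which the division excludes.
    have hzero : f - ∑ e ∈ hfin.toFinset, F e * Q e = 0 := by
      by_contra hne
      have hspan : ∑ e ∈ hfin.toFinset, F e * Q e ∈ I :=
        Submodule.sum_mem _ fun e he => I.mul_mem_right _ (hFI e (hmem e he))
      obtain ⟨e, heL, he⟩ := hL _ (I.sub_mem hf hspan) hne
      obtain ⟨e', he', hmin⟩ := exists_minimal_le_of_wellFoundedLT (· ∈ L) e heL
      refine hr e ?_ e' (hfin.mem_toFinset.2 hmin) he'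
      have hcoe : (f - ∑ e ∈ hfin.toFinset, F e * Q e).1 =
          f.1 - ∑ e ∈ hfin.toFinset, (F e).1 * q e := by
        rw [AddSubgroupClass.coe_sub, AddSubmonoidClass.coe_finsetSum]
        congr 1
        exact Finset.sum_congr rfl fun e he => by rw [← hQ e he]; rfl
      rwa [hcoe] at he
    rw [← sub_eq_zero.1 hzero] at hsum
    exact hsum

end ConvergentSeries

/-! ### Holomorphic functions of several variables -/

section Holomorphic

open Metric

variable {E F : Type} [NormedAddCommGroup E] [NormedSpace ℂ E]
  [NormedAddCommGroup F] [NormedSpace ℂ F]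

/-- The ball is mapped into the closed ball of radius `2 * M` around `f c`, and Schwarz's lemma
applies. -/
theorem norm_fderiv_le_of_bounded {f : E → F} {c : E} {R M : ℝ} (hR : 0 < R)
    (hf : DifferentiableOn ℂ f (ball c R)) (hM : ∀ z ∈ ball c R, ‖f z‖ ≤ M) :
    ‖fderiv ℂ f c‖ ≤ 2 * M / R := by
  refine Complex.norm_fderiv_le_div_of_mapsTo_ball hf (fun z hz => ?_) hR
  rw [mem_closedBall, dist_eq_norm]
  exact (norm_sub_le _ _).trans (by linarith [hM z hz, hM c (mem_ball_self hR)])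

/-- Cauchy's estimates for the derivatives of a bounded holomorphic function. -/
theorem norm_iteratedFDeriv_le_of_bounded {f : E → F} {c : E} {R M : ℝ} (hR : 0 < R)
    (hf : ContDiffOn ℂ ∞ f (ball c R)) (hM : ∀ z ∈ ball c R, ‖f z‖ ≤ M) (k : ℕ) :
    ‖iteratedFDeriv ℂ k f c‖ ≤ M * (4 * k / R) ^ k := by
  rcases Nat.eq_zero_or_pos k with rfl | hk
  · simpa using hM c (mem_ball_self hR)
  have hk' : (0 : ℝ) < k := by exact_mod_cast hk
  set δ := R / (2 * k) with hδ
  have hδ0 : 0 < δ := by positivity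
  -- Differentiate `k` times, giving up `δ` of the radius each time at the cost of a factor `2 / δ =
  -- 4 * k / R`; the total loss is only `R / 2`.
  have all : ∀ j : ℕ, j ≤ k → ∀ z ∈ ball c (R - j * δ),
      ‖iteratedFDeriv ℂ j f z‖ ≤ M * (4 * k / R) ^ j := by
    intro j
    induction j with
    | zero => intro _ z hz; simpa using hM z (by simpa using hz)
    | succ j ih =>
      intro hj z hz
      have hsub : ball z δ ⊆ ball c (R - j * δ) := by
        refine ball_subset_ball' ?_
        have := mem_ball.1 hz
        push_cast at this
        linarith
      have hsub' : ball z δ ⊆ ball c R := by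
        refine hsub.trans (ball_subset_ball ?_)
        have : (0 : ℝ) ≤ j * δ := by positivity
        linarith
      rw [← norm_fderiv_iteratedFDeriv]
      refine (norm_fderiv_le_of_bounded hδ0 ?_
        fun w hw => ih (by omega) w (hsub hw)).trans (le_of_eq ?_)
      · intro w hw
        exact ((hf.contDiffAt (isOpen_ball.mem_nhds (hsub' hw))).differentiableAt_iteratedFDeriv
          (m := j) (by exact_mod_cast
            WithTop.coe_lt_coe.2 (ENat.natCast_lt_top j))).differentiableWithinAt
      · rw [pow_succ, hδ]
        field_simp
        ring
  refine all k le_rfl c (mem_ball_self ?_)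
  have : (k : ℝ) * δ = R / 2 := by rw [hδ]; field_simp
  rw [this]
  linarith

/-- The Taylor series of a holomorphic function of several variables. -/
theorem hasSum_iteratedFDeriv [CompleteSpace F] {f : E → F} {R : ℝ}
    (hf : ContDiffOn ℂ ∞ f (ball 0 R)) {x : E} (hx : x ∈ ball 0 R) :
    HasSum (fun k : ℕ => (k.factorial : ℂ)⁻¹ • iteratedFDeriv ℂ k f 0 fun _ => x) (f x) := by
  have hx' : ‖x‖ < R := by simpa using hx
  have hR : 0 < R := (norm_nonneg x).trans_lt hx'
  -- Restriction to the complex line through `x` reduces to Taylor's theorem in one variable,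
  -- evaluated at `t = 1`.
  let L : ℂ →L[ℂ] E := (1 : ℂ →L[ℂ] ℂ).smulRight x
  have hL : ∀ t, L t = t • x := fun t => by simp [L]
  have hopen : IsOpen (L ⁻¹' ball 0 R) := isOpen_ball.preimage L.continuous
  have hmem0 : L 0 ∈ ball (0 : E) R := by simpa [hL] using hR
  have hcomp : ContDiffOn ℂ ∞ (f ∘ L) (L ⁻¹' ball 0 R) := hf.comp_continuousLinearMap L
  obtain ⟨r, hr1, hrR⟩ : ∃ r : ℝ, 1 < r ∧ r * ‖x‖ < R := by
    have hlim : Filter.Tendsto (fun r : ℝ => r * ‖x‖) (nhdsWithin 1 (Set.Ioi 1)) (nhds (1 * ‖x‖)) :=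
      ((continuous_id.mul continuous_const).tendsto 1).mono_left nhdsWithin_le_nhds
    have h1 := hlim.eventually (gt_mem_nhds (by simpa using hx'))
    obtain ⟨r, h, h'⟩ := (h1.and self_mem_nhdsWithin).exists
    exact ⟨r, h', h⟩
  have hsub : ball (0 : ℂ) r ⊆ L ⁻¹' ball 0 R := by
    intro t ht
    rw [Set.mem_preimage, hL, mem_ball_zero_iff, norm_smul]
    refine lt_of_le_of_lt ?_ hrR
    gcongr
    simpa using (mem_ball_zero_iff.1 ht).le
  have h1 := Complex.hasSum_taylorSeries_on_ball (f := f ∘ L) (c := 0) (r := r) (z := 1)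
    ((hcomp.differentiableOn (by simp)).mono hsub) (by simpa using hr1)
  have hval : (f ∘ L) 1 = f x := by simp [hL]
  rw [hval] at h1
  convert h1 using 2 with k
  rw [sub_zero, one_pow, one_smul, iteratedDeriv_eq_iteratedFDeriv,
    ← iteratedFDerivWithin_of_isOpen k hopen hmem0,
    L.iteratedFDerivWithin_comp_right hf isOpen_ball.uniqueDiffOn hopen.uniqueDiffOn hmem0
      (i := k) (by exact_mod_cast le_top), map_zero,
    iteratedFDerivWithin_of_isOpen k isOpen_ball (by simpa using hR)]
  simp [hL]

/-- A series of holomorphic functions which is normally convergent on a ball is holomorphic. -/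
theorem contDiffOn_tsum_of_bounded [CompleteSpace F] {ι : Type} {u : ι → ℝ} (hu : Summable u)
    {g : ι → E → F} {c : E} {R : ℝ} (hg : ∀ i, ContDiffOn ℂ ∞ (g i) (ball c R))
    (hb : ∀ i, ∀ y ∈ ball c R, ‖g i y‖ ≤ u i) (m : ℕ) {R' : ℝ} (hR : R' < R) :
    ContDiffOn ℂ m (fun y => ∑' i, g i y) (ball c R') := by
  -- The target must vary, since the inductive step passes to derivatives.
  induction m generalizing F R R' u with
  | zero =>
    refine contDiffOn_zero.2 (continuousOn_tsum (fun i => ?_) hu fun i y hy => hb i y ?_)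
    · exact (hg i).continuousOn.mono (ball_subset_ball hR.le)
    · exact ball_subset_ball hR.le hy
  | succ m ih =>
    rcases le_or_gt R' 0 with h0 | hpos
    · rw [ball_eq_empty.2 h0]
      exact contDiffOn_empty
    obtain ⟨R₁, hR₁, hR₁'⟩ := exists_between hR
    have hδ : 0 < R - R₁ := by linarith
    have hball : ∀ z ∈ ball c R₁, ball z (R - R₁) ⊆ ball c R := fun z hz =>
      ball_subset_ball' (by linarith [mem_ball.1 hz])
    have hd : ∀ i, ∀ z ∈ ball c R, DifferentiableAt ℂ (g i) z := fun i z hz =>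
      ((hg i).contDiffAt (isOpen_ball.mem_nhds hz)).differentiableAt (by simp)
    have hb' : ∀ i, ∀ y ∈ ball c R₁, ‖fderiv ℂ (g i) y‖ ≤ 2 * u i / (R - R₁) := fun i y hy =>
      norm_fderiv_le_of_bounded hδ
        (fun z hz => (hd i z (hball y hy hz)).differentiableWithinAt)
        fun z hz => hb i z (hball y hy hz)
    have hu' : Summable fun i => 2 * u i / (R - R₁) := (hu.mul_left 2).div_const _
    have hc : c ∈ ball c R₁ := mem_ball_self (hpos.trans hR₁)
    have hsum : ∀ y ∈ ball c R₁, HasFDerivAt (fun y => ∑' i, g i y)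
        (∑' i, fderiv ℂ (g i) y) y := fun y hy =>
      hasFDerivAt_tsum_of_isPreconnected hu' isOpen_ball (convex_ball c R₁).isPreconnected
        (fun i z hz => (hd i z (ball_subset_ball hR₁'.le hz)).hasFDerivAt) hb' hc
        (Summable.of_norm_bounded hu fun i => hb i c (ball_subset_ball hR₁'.le hc)) hy
    push_cast
    refine (contDiffOn_succ_iff_fderiv_of_isOpen isOpen_ball).2 ⟨fun y hy => ?_, ?_, ?_⟩
    · exact (hsum y (ball_subset_ball hR₁.le hy)).differentiableAt.differentiableWithinAt
    · simp
    · refine (ih hu' (g := fun i => fderiv ℂ (g i)) (R := R₁) (fun i => ?_) hb' hR₁).congr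
        fun y hy => (hsum y (ball_subset_ball hR₁.le hy)).fderiv
      exact ((contDiffOn_infty_iff_fderiv_of_isOpen isOpen_ball).1
        ((hg i).mono (ball_subset_ball hR₁'.le))).2

end Holomorphic

/-! ### Sums of convergent power series on polydiscs -/

namespace ConvergentSeries

open MvPowerSeries
open scoped ENNReal

variable {n : ℕ}

/-- The monomial `x ^ α`. -/
noncomputable def monomialAt (α : Fin n →₀ ℕ) (x : EuclideanSpace ℂ (Fin n)) : ℂ :=
  α.prod fun i k => x i ^ k

theorem monomialAt_add (α β : Fin n →₀ ℕ) (x : EuclideanSpace ℂ (Fin n)) :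
    monomialAt (α + β) x = monomialAt α x * monomialAt β x :=
  Finsupp.prod_add_index' (fun _ => pow_zero _) fun _ _ _ => pow_add _ _ _

theorem monomialAt_zero (x : EuclideanSpace ℂ (Fin n)) : monomialAt 0 x = 1 :=
  Finsupp.prod_zero_index

theorem monomialAt_single (i : Fin n) (x : EuclideanSpace ℂ (Fin n)) :
    monomialAt (Finsupp.single i 1) x = x i := by
  simp [monomialAt]

theorem contDiff_monomialAt (α : Fin n →₀ ℕ) : ContDiff ℂ ∞ (monomialAt α) := by
  unfold monomialAt Finsupp.prod
  exact contDiff_prod fun i _ => ((EuclideanSpace.proj (𝕜 := ℂ) i).contDiff).pow _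

/-- The closed polydisc on which the series with finite `s`-th norm converge absolutely. -/
def polydisc (n s : ℕ) : Set (EuclideanSpace ℂ (Fin n)) :=
  {x | ∀ i, ‖x i‖ₑ ≤ weight s (Finsupp.single i 1)}

theorem exists_ball_subset_polydisc (n s : ℕ) : ∃ r > 0, Metric.ball 0 r ⊆ polydisc n s := by
  have : ∀ᶠ x : EuclideanSpace ℂ (Fin n) in nhds 0, ∀ i,
      ‖x i‖ₑ ≤ weight s (Finsupp.single i 1) := by
    refine Filter.eventually_all.2 fun i => ?_
    have h : Filter.Tendsto (fun x : EuclideanSpace ℂ (Fin n) => ‖x i‖ₑ) (nhds 0) (nhds 0) := by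
      have := ((EuclideanSpace.proj (𝕜 := ℂ) i).continuous.enorm).tendsto
        (0 : EuclideanSpace ℂ (Fin n))
      simpa using this
    exact h.eventually_le_const (pos_iff_ne_zero.2 (weight_ne_zero _ _))
  obtain ⟨r, hr, h⟩ := Metric.eventually_nhds_iff_ball.1 this
  exact ⟨r, hr, h⟩

theorem enorm_monomialAt_le {s : ℕ} {x : EuclideanSpace ℂ (Fin n)} (hx : x ∈ polydisc n s)
    (α : Fin n →₀ ℕ) : ‖monomialAt α x‖ₑ ≤ weight s α := by
  induction α using Finsupp.induction_linear with
  | zero => simp [monomialAt_zero, weight_zero]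
  | add f g hf hg =>
    rw [monomialAt_add, weight_add, enorm_mul]
    exact mul_le_mul' hf hg
  | single i k =>
    induction k with
    | zero => simp [monomialAt_zero, weight_zero]
    | succ k ih =>
      rw [Finsupp.single_add, monomialAt_add, weight_add, enorm_mul, monomialAt_single]
      exact mul_le_mul' ih (hx i)

/-- The sum of a power series at a point. -/
noncomputable def sumAt (f : MvPowerSeries (Fin n) ℂ) (x : EuclideanSpace ℂ (Fin n)) : ℂ :=
  ∑' α, coeff α f * monomialAt α x

section

variable {s : ℕ} {f g : MvPowerSeries (Fin n) ℂ}

theorem summable_bound (hf : wnorm s f ≠ ⊤) :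
    Summable fun α => (‖coeff α f‖ₑ * weight s α).toReal :=
  ENNReal.summable_toReal hf

theorem norm_term_le {x : EuclideanSpace ℂ (Fin n)} (hx : x ∈ polydisc n s) (α : Fin n →₀ ℕ) :
    ‖coeff α f * monomialAt α x‖ ≤ (‖coeff α f‖ₑ * weight s α).toReal := by
  rw [← toReal_enorm, enorm_mul]
  exact ENNReal.toReal_mono (ENNReal.mul_ne_top enorm_ne_top (weight_ne_top _ _))
    (mul_le_mul_right (enorm_monomialAt_le hx α) _)

theorem summable_norm_term (hf : wnorm s f ≠ ⊤) {x : EuclideanSpace ℂ (Fin n)}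
    (hx : x ∈ polydisc n s) : Summable fun α => ‖coeff α f * monomialAt α x‖ :=
  Summable.of_nonneg_of_le (fun _ => norm_nonneg _) (norm_term_le hx) (summable_bound hf)

theorem sumAt_add (hf : wnorm s f ≠ ⊤) (hg : wnorm s g ≠ ⊤) {x : EuclideanSpace ℂ (Fin n)}
    (hx : x ∈ polydisc n s) : sumAt (f + g) x = sumAt f x + sumAt g x := by
  rw [sumAt, sumAt, sumAt, ← (summable_norm_term hf hx).of_norm.tsum_add
    (summable_norm_term hg hx).of_norm]
  simp [add_mul]

theorem sumAt_mul (hf : wnorm s f ≠ ⊤) (hg : wnorm s g ≠ ⊤) {x : EuclideanSpace ℂ (Fin n)}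
    (hx : x ∈ polydisc n s) : sumAt (f * g) x = sumAt f x * sumAt g x := by
  classical
  have h1 := summable_norm_term hf hx
  have h2 := summable_norm_term hg hx
  have h3 := summable_mul_of_summable_norm h1 h2
  have key := Summable.tsum_mul_tsum_eq_tsum_sum_antidiagonal h1.of_norm h2.of_norm h3
  have h4 : ∀ α, coeff α (f * g) * monomialAt α x =
      ∑ p ∈ Finset.HasAntidiagonal.antidiagonal α,
        coeff p.1 f * monomialAt p.1 x * (coeff p.2 g * monomialAt p.2 x) := by
    intro α
    rw [coeff_mul, Finset.sum_mul]
    refine Finset.sum_congr rfl fun p hp => ?_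
    rw [← Finset.HasAntidiagonal.mem_antidiagonal.1 hp, monomialAt_add]
    ring
  simp_rw [sumAt, h4]
  exact key.symm

theorem sumAt_C (c : ℂ) (x : EuclideanSpace ℂ (Fin n)) : sumAt (C c) x = c := by
  classical
  rw [sumAt, tsum_eq_single 0]
  · simp [monomialAt_zero]
  · intro α hα
    simp [coeff_C, hα]

theorem contDiffOn_sumAt (hf : wnorm s f ≠ ⊤) {r r' : ℝ} (hr : Metric.ball 0 r ⊆ polydisc n s)
    (hr' : r' < r) : ContDiffOn ℂ ∞ (sumAt f) (Metric.ball 0 r') :=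
  contDiffOn_infty.2 fun m => contDiffOn_tsum_of_bounded (summable_bound hf)
    (fun α => (contDiff_const.mul (contDiff_monomialAt α)).contDiffOn)
    (fun α _ hy => norm_term_le (hr hy) α) m hr'

end

/-! ### The power series expansion of a holomorphic function -/

/-- The exponent of the monomial `x_{v 0} ⋯ x_{v (k - 1)}`. -/
noncomputable def wordExponent (w : Σ k : ℕ, Fin k → Fin n) : Fin n →₀ ℕ :=
  ∑ j, Finsupp.single (w.2 j) 1

theorem monomialAt_wordExponent (w : Σ k : ℕ, Fin k → Fin n) (x : EuclideanSpace ℂ (Fin n)) :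
    monomialAt (wordExponent w) x = ∏ j, x (w.2 j) := by
  classical
  unfold wordExponent
  induction (Finset.univ : Finset (Fin w.1)) using Finset.induction_on with
  | empty => simp [monomialAt_zero]
  | insert a t ha ih =>
    rw [Finset.sum_insert ha, monomialAt_add, monomialAt_single, ih, Finset.prod_insert ha]

theorem weight_single_le (s : ℕ) (i : Fin n) :
    weight s (Finsupp.single i 1) ≤ (2⁻¹ : ℝ≥0∞) ^ s := by
  unfold weight index
  simp only [Finsupp.prod_single_index, pow_zero, pow_one]
  gcongr
  exact_mod_cast (prime_nth i).two_le

theorem weight_wordExponent_le (s : ℕ) (w : Σ k : ℕ, Fin k → Fin n) :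
    weight s (wordExponent w) ≤ ((2⁻¹ : ℝ≥0∞) ^ s) ^ w.1 := by
  classical
  unfold wordExponent
  have : ∀ t : Finset (Fin w.1), weight s (∑ j ∈ t, Finsupp.single (w.2 j) 1) ≤
      ((2⁻¹ : ℝ≥0∞) ^ s) ^ t.card := by
    intro t
    induction t using Finset.induction_on with
    | empty => simp [weight_zero]
    | insert a t ha ih =>
      rw [Finset.sum_insert ha, weight_add, Finset.card_insert_of_notMem ha, pow_succ']
      exact mul_le_mul' (weight_single_le s _) ih
  simpa using this Finset.univ

/-- The Taylor coefficients of `f` at `0`, indexed by words in the variables. -/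
noncomputable def wordCoeff (f : EuclideanSpace ℂ (Fin n) → ℂ) (w : Σ k : ℕ, Fin k → Fin n) : ℂ :=
  (w.1.factorial : ℂ)⁻¹ * iteratedFDeriv ℂ w.1 f 0 fun j => EuclideanSpace.single (w.2 j) 1

/-- The Taylor series of `f` at `0`. -/
noncomputable def taylorSeries (f : EuclideanSpace ℂ (Fin n) → ℂ) : MvPowerSeries (Fin n) ℂ :=
  fun α => ∑' w : {w : Σ k : ℕ, Fin k → Fin n // wordExponent w = α}, wordCoeff f w

theorem coeff_taylorSeries (f : EuclideanSpace ℂ (Fin n) → ℂ) (α : Fin n →₀ ℕ) :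
    coeff α (taylorSeries f) =
      ∑' w : {w : Σ k : ℕ, Fin k → Fin n // wordExponent w = α}, wordCoeff f w := rfl

/-- Expand `x` in the standard basis by multilinearity. Words rather than exponents index this
expansion, which avoids multinomial coefficients. -/
theorem sum_wordCoeff (f : EuclideanSpace ℂ (Fin n) → ℂ) (k : ℕ)
    (x : EuclideanSpace ℂ (Fin n)) :
    ∑ v : Fin k → Fin n, wordCoeff f ⟨k, v⟩ * ∏ j, x (v j) =
      (k.factorial : ℂ)⁻¹ • iteratedFDeriv ℂ k f 0 fun _ => x := by
  classical
  have hx : x = ∑ i, x i • EuclideanSpace.single i (1 : ℂ) := by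
    ext j
    simp [Finset.sum_apply, Pi.single_apply]
  conv_rhs => rw [hx]
  rw [ContinuousMultilinearMap.map_sum, Finset.smul_sum]
  refine Finset.sum_congr rfl fun v _ => ?_
  rw [ContinuousMultilinearMap.map_smul_univ, wordCoeff, smul_eq_mul, smul_eq_mul]
  ring

variable {f : EuclideanSpace ℂ (Fin n) → ℂ} {R M : ℝ}

/-- Cauchy's estimate grows like `k ^ k`, and dividing by `k!` leaves at most `e ^ k`. -/
theorem norm_wordCoeff_le (hR : 0 < R) (hf : ContDiffOn ℂ ∞ f (Metric.ball 0 R))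
    (hM : ∀ z ∈ Metric.ball 0 R, ‖f z‖ ≤ M) (w : Σ k : ℕ, Fin k → Fin n) :
    ‖wordCoeff f w‖ ≤ M * (4 * Real.exp 1 / R) ^ w.1 := by
  obtain ⟨k, v⟩ := w
  have hM0 : 0 ≤ M := (norm_nonneg _).trans (hM 0 (Metric.mem_ball_self hR))
  have h1 : ‖iteratedFDeriv ℂ k f 0 fun j => EuclideanSpace.single (v j) (1 : ℂ)‖ ≤
      M * (4 * k / R) ^ k := by
    refine (ContinuousMultilinearMap.le_opNorm _ _).trans ?_
    simpa using norm_iteratedFDeriv_le_of_bounded hR hf hM k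
  have h2 : (k : ℝ) ^ k / k.factorial ≤ Real.exp 1 ^ k := by
    rw [← Real.exp_nat_mul, mul_one]
    exact Real.pow_div_factorial_le_exp _ (Nat.cast_nonneg k) k
  rw [wordCoeff, norm_mul, norm_inv, Complex.norm_natCast]
  calc (k.factorial : ℝ)⁻¹ * _ ≤ (k.factorial : ℝ)⁻¹ * (M * (4 * k / R) ^ k) := by gcongr
    _ = M * (4 / R) ^ k * ((k : ℝ) ^ k / k.factorial) := by
      rw [div_pow, div_pow, mul_pow]; ring
    _ ≤ M * (4 / R) ^ k * Real.exp 1 ^ k := by gcongr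
    _ = _ := by rw [mul_assoc, ← mul_pow]; congr 2; ring

/-- There are `n ^ k` words of length `k`, so the sum is dominated by a geometric series, whose
ratio is below `1` once `s` is large. -/
theorem exists_tsum_wordCoeff_ne_top (hR : 0 < R) (hf : ContDiffOn ℂ ∞ f (Metric.ball 0 R))
    (hM : ∀ z ∈ Metric.ball 0 R, ‖f z‖ ≤ M) :
    ∃ s, ∑' w, ‖wordCoeff f w‖ₑ * weight s (wordExponent w) ≠ ⊤ := by
  set A : ℝ≥0∞ := n * ENNReal.ofReal (4 * Real.exp 1 / R) with hA
  have hAtop : A ≠ ⊤ := ENNReal.mul_ne_top (by simp) ENNReal.ofReal_ne_top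
  have hlim : Filter.Tendsto (fun s : ℕ => A * (2⁻¹ : ℝ≥0∞) ^ s) Filter.atTop (nhds 0) := by
    rw [← mul_zero A]
    exact ENNReal.Tendsto.const_mul
      (ENNReal.tendsto_pow_atTop_nhds_zero_of_lt_one (by simp)) (Or.inr hAtop)
  obtain ⟨s, hs⟩ := (hlim.eventually (gt_mem_nhds one_pos)).exists
  refine ⟨s, ne_top_of_le_ne_top (b := ENNReal.ofReal M * ∑' k, (A * (2⁻¹ : ℝ≥0∞) ^ s) ^ k) ?_ ?_⟩
  · refine ENNReal.mul_ne_top ENNReal.ofReal_ne_top ?_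
    rw [ENNReal.tsum_geometric, ne_eq, ENNReal.inv_eq_top, tsub_eq_zero_iff_le, not_le]
    exact hs
  · rw [ENNReal.tsum_sigma', ← ENNReal.tsum_mul_left]
    refine ENNReal.tsum_le_tsum fun k => ?_
    rw [tsum_fintype]
    calc ∑ v : Fin k → Fin n, ‖wordCoeff f ⟨k, v⟩‖ₑ * weight s (wordExponent ⟨k, v⟩)
        ≤ ∑ v : Fin k → Fin n, ENNReal.ofReal M *
            ENNReal.ofReal (4 * Real.exp 1 / R) ^ k * ((2⁻¹ : ℝ≥0∞) ^ s) ^ k := by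
          refine Finset.sum_le_sum fun v _ => ?_
          refine mul_le_mul' ?_ (weight_wordExponent_le s ⟨k, v⟩)
          rw [← ENNReal.ofReal_pow (by positivity), ← ENNReal.ofReal_mul, ← ofReal_norm]
          · exact ENNReal.ofReal_le_ofReal (norm_wordCoeff_le hR hf hM ⟨k, v⟩)
          · exact (norm_nonneg _).trans (hM 0 (Metric.mem_ball_self hR))
      _ = _ := by
          rw [Finset.sum_const, Finset.card_univ, Fintype.card_fun, Fintype.card_fin,
            Fintype.card_fin, hA, mul_pow, mul_pow, nsmul_eq_mul]
          push_cast
          ring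

/-- The absolutely convergent sum over words can be grouped by exponent, giving the power series, or
by length, giving the Taylor expansion of `f`. -/
theorem exists_sumAt_taylorSeries (hR : 0 < R) (hf : ContDiffOn ℂ ∞ f (Metric.ball 0 R))
    (hM : ∀ z ∈ Metric.ball 0 R, ‖f z‖ ≤ M) :
    taylorSeries f ∈ convergentSeries n ∧ ∀ᶠ x in nhds 0, sumAt (taylorSeries f) x = f x := by
  obtain ⟨s, hs⟩ := exists_tsum_wordCoeff_ne_top hR hf hM
  let e := Equiv.sigmaFiberEquiv (wordExponent (n := n))
  refine ⟨⟨s, ne_top_of_le_ne_top hs ?_⟩, ?_⟩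
  · rw [← e.tsum_eq, ENNReal.tsum_sigma', wnorm]
    refine ENNReal.tsum_le_tsum fun α => ?_
    rw [coeff_taylorSeries]
    refine (mul_le_mul_left enorm_tsum_le_tsum_enorm _).trans ?_
    rw [← ENNReal.tsum_mul_right]
    refine le_of_eq (tsum_congr ?_)
    rintro ⟨w, rfl⟩
    rfl
  · obtain ⟨r, hr, hrs⟩ := exists_ball_subset_polydisc n s
    filter_upwards [Metric.ball_mem_nhds 0 hr, Metric.ball_mem_nhds 0 hR] with x hx hxR
    have hsum : Summable fun w => wordCoeff f w * monomialAt (wordExponent w) x := by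
      refine Summable.of_norm_bounded (ENNReal.summable_toReal hs) fun w => ?_
      rw [← toReal_enorm, enorm_mul]
      exact ENNReal.toReal_mono (ENNReal.mul_ne_top enorm_ne_top (weight_ne_top _ _))
        (mul_le_mul_right (enorm_monomialAt_le (hrs hx) _) _)
    have h1 : HasSum (fun k => ∑ v : Fin k → Fin n, wordCoeff f ⟨k, v⟩ *
        monomialAt (wordExponent ⟨k, v⟩) x) (∑' w, wordCoeff f w * monomialAt (wordExponent w) x) :=
      hsum.hasSum.sigma fun k => hasSum_fintype _
    simp_rw [monomialAt_wordExponent, sum_wordCoeff] at h1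
    rw [← h1.unique (hasSum_iteratedFDeriv hf hxR)]
    simp_rw [← monomialAt_wordExponent]
    rw [← e.tsum_eq]
    refine Eq.trans ?_ (Summable.tsum_sigma (e.summable_iff.2 hsum)).symm
    refine tsum_congr fun α => ?_
    rw [coeff_taylorSeries, ← tsum_mul_right]
    refine tsum_congr ?_
    rintro ⟨w, rfl⟩
    rfl

end ConvergentSeries

/-! ### The stalks of the sheaf of holomorphic functions -/

section Affine

variable {n : ℕ}

/-- The stalk `𝒪_{ℂⁿ, y}`. -/
abbrev AffineStalk (y : EuclideanSpace ℂ (Fin n)) : Type :=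
  (affineCSpace n).space.presheaf.stalk y

/-- The element `a` of the stalk at `y` is the germ of the function `g`. -/
def IsGermOf (y : EuclideanSpace ℂ (Fin n)) (g : EuclideanSpace ℂ (Fin n) → ℂ)
    (a : AffineStalk y) : Prop :=
  ∃ (U : Opens (EuclideanSpace ℂ (Fin n))) (hy : y ∈ U) (F : HolomorphicOn U),
    holomorphicGerm F y hy = a ∧ ∀ z : U, F z = g z

theorem holomorphicGerm_restrict {U V : Opens (EuclideanSpace ℂ (Fin n))} (h : V ≤ U)
    (F : HolomorphicOn U) (y : EuclideanSpace ℂ (Fin n)) (hy : y ∈ V) :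
    holomorphicGerm (ContMDiffMap.restrictRingHom 𝓘(ℂ, EuclideanSpace ℂ (Fin n)) 𝓘(ℂ) ℂ h F) y hy =
      holomorphicGerm F y (h hy) :=
  (affineCSpace n).space.presheaf.germ_res_apply (homOfLE h) y hy F

variable {y : EuclideanSpace ℂ (Fin n)} {g h : EuclideanSpace ℂ (Fin n) → ℂ}
  {a b : AffineStalk y}

theorem IsGermOf.exists_pair (ha : IsGermOf y g a) (hb : IsGermOf y h b)
    {s : Set (EuclideanSpace ℂ (Fin n))} (hs : s ∈ nhds y) :
    ∃ (U : Opens (EuclideanSpace ℂ (Fin n))) (hy : y ∈ U) (F G : HolomorphicOn U),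
      (U : Set (EuclideanSpace ℂ (Fin n))) ⊆ s ∧
      holomorphicGerm F y hy = a ∧ holomorphicGerm G y hy = b ∧
      ∀ z : U, F z = g z ∧ G z = h z := by
  obtain ⟨U, hyU, F, hF, hFg⟩ := ha
  obtain ⟨V, hyV, G, hG, hGh⟩ := hb
  obtain ⟨W, hWs, hW, hyW⟩ := mem_nhds_iff.1 hs
  let T : Opens (EuclideanSpace ℂ (Fin n)) := U ⊓ V ⊓ ⟨W, hW⟩
  have hTU : T ≤ U := inf_le_left.trans inf_le_left
  have hTV : T ≤ V := inf_le_left.trans inf_le_right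
  have hT : y ∈ T := ⟨⟨hyU, hyV⟩, hyW⟩
  exact ⟨T, hT, _, _, fun z hz => hWs hz.2, (holomorphicGerm_restrict hTU F y hT).trans hF,
    (holomorphicGerm_restrict hTV G y hT).trans hG,
    fun z => ⟨hFg ⟨z, hTU z.2⟩, hGh ⟨z, hTV z.2⟩⟩⟩

theorem IsGermOf.unique (ha : IsGermOf y g a) (hb : IsGermOf y h b) (hgh : g =ᶠ[nhds y] h) :
    a = b := by
  obtain ⟨U, hy, F, G, hU, rfl, rfl, hFG⟩ := ha.exists_pair hb hgh
  congr 1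
  ext z
  rw [(hFG z).1, (hFG z).2]
  exact hU z.2

theorem IsGermOf.add (ha : IsGermOf y g a) (hb : IsGermOf y h b) :
    IsGermOf y (fun z => g z + h z) (a + b) := by
  obtain ⟨U, hy, F, G, -, rfl, rfl, hFG⟩ := ha.exists_pair hb Filter.univ_mem
  refine ⟨U, hy, F + G, map_add ((affineCSpace n).space.presheaf.germ U y hy).hom F G, fun z => ?_⟩
  change F z + G z = g z + h z
  rw [(hFG z).1, (hFG z).2]

theorem IsGermOf.mul (ha : IsGermOf y g a) (hb : IsGermOf y h b) :
    IsGermOf y (fun z => g z * h z) (a * b) := by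
  obtain ⟨U, hy, F, G, -, rfl, rfl, hFG⟩ := ha.exists_pair hb Filter.univ_mem
  refine ⟨U, hy, F * G, map_mul ((affineCSpace n).space.presheaf.germ U y hy).hom F G, fun z => ?_⟩
  change F z * G z = g z * h z
  rw [(hFG z).1, (hFG z).2]

theorem isGermOf_zero (y : EuclideanSpace ℂ (Fin n)) : IsGermOf y (fun _ => 0) 0 :=
  ⟨⊤, trivial, 0, map_zero ((affineCSpace n).space.presheaf.germ ⊤ y trivial).hom, fun _ => rfl⟩

theorem isGermOf_one (y : EuclideanSpace ℂ (Fin n)) : IsGermOf y (fun _ => 1) 1 :=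
  ⟨⊤, trivial, 1, map_one ((affineCSpace n).space.presheaf.germ ⊤ y trivial).hom, fun _ => rfl⟩

theorem exists_isGermOf {r : ℝ} (hr : 0 < r) (hg : ContDiffOn ℂ ∞ g (Metric.ball y r)) :
    ∃ a, IsGermOf y g a := by
  let U : Opens (EuclideanSpace ℂ (Fin n)) := ⟨Metric.ball y r, Metric.isOpen_ball⟩
  have hy : y ∈ U := Metric.mem_ball_self hr
  let F : HolomorphicOn U := ⟨fun z => g z,
    hg.contMDiffOn.comp_contMDiff contMDiff_subtype_val fun z => z.2⟩
  exact ⟨_, U, hy, F, rfl, fun _ => rfl⟩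

theorem exists_function (a : AffineStalk y) :
    ∃ g, IsGermOf y g a ∧ ∃ r > 0, ContDiffOn ℂ ∞ g (Metric.ball y r) := by
  classical
  obtain ⟨U, hy, F, rfl⟩ : ∃ (U : Opens (EuclideanSpace ℂ (Fin n))) (hy : y ∈ U)
      (F : HolomorphicOn U), holomorphicGerm F y hy = a :=
    (affineCSpace n).space.presheaf.exists_germ_eq a
  let g : EuclideanSpace ℂ (Fin n) → ℂ := fun z => if h : z ∈ U then F ⟨z, h⟩ else 0
  have hg : ∀ z : U, g z = F z := fun z => dif_pos z.2
  obtain ⟨r, hr, hrU⟩ := Metric.isOpen_iff.1 U.isOpen y hy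
  refine ⟨g, ⟨U, hy, F, rfl, fun z => (hg z).symm⟩, r, hr, fun z hz => ?_⟩
  have h1 : ContMDiffAt 𝓘(ℂ, EuclideanSpace ℂ (Fin n)) 𝓘(ℂ) ∞ (fun z : U => g z) ⟨z, hrU hz⟩ := by
    simp_rw [hg]
    exact F.contMDiff _
  exact (contMDiffAt_iff_contDiffAt.1 (contMDiffAt_subtype_iff.1 h1)).contDiffWithinAt

open ConvergentSeries in
theorem exists_isGermOf_sumAt (y : EuclideanSpace ℂ (Fin n)) (f : convergentSeries n) :
    ∃ a, IsGermOf y (fun z => sumAt f.1 (z - y)) a := by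
  obtain ⟨s, hs⟩ := f.2
  obtain ⟨r, hr, hrs⟩ := exists_ball_subset_polydisc n s
  refine exists_isGermOf (r := r / 2) (by positivity)
    ((contDiffOn_sumAt hs hrs (half_lt_self hr)).comp
      (contDiff_id.sub contDiff_const).contDiffOn fun z hz => ?_)
  simpa [dist_eq_norm] using hz

open ConvergentSeries in
theorem eventually_sub_mem_polydisc (y : EuclideanSpace ℂ (Fin n)) (s : ℕ) :
    ∀ᶠ z in nhds y, z - y ∈ polydisc n s := by
  obtain ⟨r, hr, hrs⟩ := exists_ball_subset_polydisc n s
  filter_upwards [Metric.ball_mem_nhds y hr] with z hz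
  exact hrs (by simpa [dist_eq_norm] using hz)

open ConvergentSeries in
/-- The germ at `y` of the sum of a convergent power series in `z - y`. -/
noncomputable def sumGerm (y : EuclideanSpace ℂ (Fin n)) :
    convergentSeries n →+* AffineStalk y where
  toFun f := (exists_isGermOf_sumAt y f).choose
  map_zero' := (exists_isGermOf_sumAt y 0).choose_spec.unique (isGermOf_zero y)
    (Filter.Eventually.of_forall fun z => by simpa using sumAt_C 0 (z - y))
  map_one' := (exists_isGermOf_sumAt y 1).choose_spec.unique (isGermOf_one y)
    (Filter.Eventually.of_forall fun z => by simpa using sumAt_C 1 (z - y))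
  map_add' f g := by
    obtain ⟨s, hs⟩ := f.2
    obtain ⟨t, ht⟩ := g.2
    refine (exists_isGermOf_sumAt y (f + g)).choose_spec.unique
      ((exists_isGermOf_sumAt y f).choose_spec.add (exists_isGermOf_sumAt y g).choose_spec) ?_
    filter_upwards [eventually_sub_mem_polydisc y (max s t)] with z hz
    exact sumAt_add (ne_top_of_le_ne_top hs (wnorm_anti f.1 (le_max_left _ _)))
      (ne_top_of_le_ne_top ht (wnorm_anti g.1 (le_max_right _ _))) hz
  map_mul' f g := by
    obtain ⟨s, hs⟩ := f.2
    obtain ⟨t, ht⟩ := g.2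
    refine (exists_isGermOf_sumAt y (f * g)).choose_spec.unique
      ((exists_isGermOf_sumAt y f).choose_spec.mul (exists_isGermOf_sumAt y g).choose_spec) ?_
    filter_upwards [eventually_sub_mem_polydisc y (max s t)] with z hz
    exact sumAt_mul (ne_top_of_le_ne_top hs (wnorm_anti f.1 (le_max_left _ _)))
      (ne_top_of_le_ne_top ht (wnorm_anti g.1 (le_max_right _ _))) hz

open ConvergentSeries in
-- Translate to the origin, shrink until the function is bounded, and take its Taylor series. This
-- carries Noetherianity over to the stalks.
theorem sumGerm_surjective (y : EuclideanSpace ℂ (Fin n)) : Function.Surjective (sumGerm y) := by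
  intro a
  obtain ⟨g, hga, r, hr, hg⟩ := exists_function a
  let f : EuclideanSpace ℂ (Fin n) → ℂ := fun x => g (x + y)
  have hmaps : Set.MapsTo (fun x => x + y) (Metric.ball 0 r) (Metric.ball y r) := by
    intro x hx
    simpa [dist_eq_norm] using hx
  have hf : ContDiffOn ℂ ∞ f (Metric.ball 0 r) :=
    hg.comp (contDiff_id.add contDiff_const).contDiffOn hmaps
  have hf0 : ContinuousAt f 0 := hf.continuousOn.continuousAt (Metric.ball_mem_nhds 0 hr)
  obtain ⟨r', hr', hM⟩ : ∃ r' > 0, ∀ x ∈ Metric.ball 0 r', ‖f x‖ ≤ ‖f 0‖ + 1 :=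
    Metric.eventually_nhds_iff_ball.1
      (hf0.norm.eventually_le_const (by linarith))
  obtain ⟨hmem, hev⟩ := exists_sumAt_taylorSeries (f := f) (R := min r r') (lt_min hr hr')
    (hf.mono (Metric.ball_subset_ball (min_le_left _ _)))
    fun z hz => hM z (Metric.ball_subset_ball (min_le_right _ _) hz)
  refine ⟨⟨taylorSeries f, hmem⟩, (exists_isGermOf_sumAt y _).choose_spec.unique hga ?_⟩
  have htend : Filter.Tendsto (fun z => z - y) (nhds y) (nhds 0) := by
    rw [← sub_self y]
    exact (continuous_sub_right y).tendsto y
  filter_upwards [htend.eventually hev] with z hz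
  simpa [f] using hz

instance isNoetherianRing_affineStalk (y : EuclideanSpace ℂ (Fin n)) :
    IsNoetherianRing (AffineStalk y) :=
  isNoetherianRing_of_surjective _ _ (sumGerm y) (sumGerm_surjective y)

theorem not_isUnit_of_isGermOf (ha : IsGermOf y g a) (hg : g y = 0) : ¬ IsUnit a := by
  obtain ⟨U, hy, F, rfl, hF⟩ := ha
  intro hu
  refine (smoothSheafCommRing.isUnit_stalk_iff 𝓘(ℂ, EuclideanSpace ℂ (Fin n)) _).1 hu ?_
  refine (smoothSheafCommRing.evalHom_germ 𝓘(ℂ, EuclideanSpace ℂ (Fin n)) 𝓘(ℂ)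
    (EuclideanSpace ℂ (Fin n)) ℂ U y hy F).trans ?_
  exact (hF ⟨y, hy⟩).trans hg

/-- The stalk at a point has residue field `ℂ`. -/
theorem exists_const_sub_not_isUnit (a : AffineStalk y) : ∃ c : ℂ,
    ¬ IsUnit (a - (affineCSpace n).space.presheaf.germ ⊤ y trivial
      ((affineCSpace n).const.hom c)) := by
  obtain ⟨g, hga, -⟩ := exists_function a
  refine ⟨g y, ?_⟩
  have h1 : IsGermOf y (fun _ => -g y) (-(affineCSpace n).space.presheaf.germ ⊤ y trivial
      ((affineCSpace n).const.hom (g y))) := by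
    refine ⟨⊤, trivial, -algebraMap ℂ (HolomorphicOn ⊤) (g y),
      map_neg ((affineCSpace n).space.presheaf.germ ⊤ y trivial).hom _, fun z => rfl⟩
  rw [sub_eq_add_neg]
  exact not_isUnit_of_isGermOf (hga.add h1) (by simp)

end Affine

/-! ### Global sections -/

namespace CSpace

/-- The ring of global sections. -/
abbrev Sec (X : CSpace) : Type := X.space.presheaf.obj (op ⊤)

/-- The germ of a global section at a point. -/
noncomputable def germ (X : CSpace) (x : X.space.toTopCat) : X.Sec →+* X.space.presheaf.stalk x :=
  (X.space.presheaf.germ ⊤ x trivial).hom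

/-- The constants, as global sections. -/
noncomputable def constHom (X : CSpace) : ℂ →+* X.Sec := X.const.hom

/-- The pull-back of global sections. -/
noncomputable def Hom.pull {X Y : CSpace} (f : X ⟶ Y) : Y.Sec →+* X.Sec :=
  (LocallyRingedSpace.Γ.map (Hom.map f).op).hom

theorem Hom.pull_constHom {X Y : CSpace} (f : X ⟶ Y) (c : ℂ) :
    Hom.pull f (Y.constHom c) = X.constHom c :=
  congrArg (fun k => k.hom c) (Hom.const_comp f)

theorem Hom.stalkMap_germ {X Y : CSpace} (f : X ⟶ Y) (x : X.space.toTopCat) (s : Y.Sec) :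
    Hom.stalkMap f x (Y.germ (Hom.base f x) s) = X.germ x (Hom.pull f s) :=
  LocallyRingedSpace.stalkMap_germ_apply (Hom.map f) ⊤ x trivial s

theorem Hom.isUnit_of_stalkMap {X Y : CSpace} (f : X ⟶ Y) (x : X.space.toTopCat)
    {a : Y.space.presheaf.stalk (Hom.base f x)} (h : IsUnit (Hom.stalkMap f x a)) : IsUnit a :=
  (LocallyRingedSpace.isLocalHomStalkMap (Hom.map f) x).map_nonunit a h

/-- The stalk of a space with local presentations at a point is Noetherian, with residue field
`ℂ`. -/
theorem stalk_of_presentation {X : CSpace} {x : X.space.toTopCat} (c : LocalPresentation X x) :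
    IsNoetherianRing (X.space.presheaf.stalk x) ∧
      ∀ a : X.space.presheaf.stalk x, ∃ k : ℂ, ¬ IsUnit (a - X.germ x (X.constHom k)) := by
  let y : (X.restrict c.V).space.toTopCat := (⟨x, c.mem⟩ : c.V)
  let ρ := Hom.stalkMap c.j y
  let σ : X.space.presheaf.stalk x →+* (X.restrict c.V).space.presheaf.stalk y :=
    Hom.stalkMap (X.ofRestrict c.V) y
  have hσ : Function.Bijective σ := by
    have h : IsIso (LocallyRingedSpace.Hom.stalkMap (X.space.ofRestrict c.V.isOpenEmbedding) y) :=
      PresheafedSpace.ofRestrict_stalkMap_isIso _ _ _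
    exact (ConcreteCategory.isIso_iff_bijective _).1 h
  constructor
  · have : IsNoetherianRing (AffineStalk (Hom.base c.j y)) :=
      isNoetherianRing_affineStalk (Hom.base c.j y)
    have h2 : IsNoetherianRing ((X.restrict c.V).space.presheaf.stalk y) :=
      isNoetherianRing_of_surjective _ _ ρ (c.surjective y)
    exact isNoetherianRing_of_ringEquiv _ (RingEquiv.ofBijective σ hσ).symm
  · intro a
    obtain ⟨b, hb⟩ := c.surjective y (σ a)
    obtain ⟨k, hk⟩ := exists_const_sub_not_isUnit (y := Hom.base c.j y) b
    refine ⟨k, fun hu => hk (Hom.isUnit_of_stalkMap c.j y ?_)⟩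
    have h1 : ρ ((affineCSpace c.n).germ _ ((affineCSpace c.n).constHom k)) =
        (X.restrict c.V).germ y ((X.restrict c.V).constHom k) := by
      rw [← Hom.pull_constHom c.j]
      exact Hom.stalkMap_germ c.j y _
    have h2 : σ (X.germ x (X.constHom k)) =
        (X.restrict c.V).germ y ((X.restrict c.V).constHom k) := by
      rw [← Hom.pull_constHom (X.ofRestrict c.V)]
      exact Hom.stalkMap_germ (X.ofRestrict c.V) y _
    have h3 := hu.map σ
    rw [map_sub, h2, ← h1, ← hb] at h3
    refine Eq.mp (congrArg IsUnit ?_) h3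
    exact (map_sub ρ _ _).symm

/-! ### Morphisms to one-point spaces -/

section Point

variable {X Y : CSpace} [Subsingleton Y.space.toTopCat]

theorem opens_eq_top (U : Opens Y.space.toTopCat) {y : Y.space.toTopCat} (hy : y ∈ U) : U = ⊤ := by
  ext z
  rw [Subsingleton.elim z y]
  simpa using hy

theorem germ_bijective (y : Y.space.toTopCat) : Function.Bijective (Y.germ y) := by
  constructor
  · intro s t hst
    obtain ⟨W, hW, i, i', h⟩ := Y.space.presheaf.germ_eq y (Opens.mem_top y) (Opens.mem_top y) s t hst
    obtain rfl := opens_eq_top W hW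
    have hi : i = 𝟙 _ := Subsingleton.elim _ _
    have hi' : i' = 𝟙 _ := Subsingleton.elim _ _
    subst hi hi'
    simpa using h
  · intro a
    obtain ⟨W, hW, s, hs⟩ := Y.space.presheaf.exists_germ_eq a
    obtain rfl := opens_eq_top W hW
    exact ⟨s, hs⟩

/-- A morphism to a one-point space is determined by its effect on global sections. -/
theorem hom_ext_of_pull {f g : X ⟶ Y} (h : Hom.pull f = Hom.pull g) : f = g := by
  obtain ⟨⟨⟨bf, cf⟩, pf⟩, hf⟩ := f
  obtain ⟨⟨⟨bg, cg⟩, pg⟩, hg⟩ := g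
  have hb : bf = bg := by
    ext x
    exact @Subsingleton.elim Y.space.toTopCat _ _ _
  subst hb
  have hc : cf = cg := by
    apply NatTrans.ext
    funext U
    ext s
    refine TopCat.Presheaf.section_ext X.space.sheaf _ _ _ fun x hx => ?_
    obtain ⟨U⟩ := U
    obtain rfl := opens_eq_top U hx
    congr 1
    exact congrArg (fun k : Y.Sec →+* X.Sec => k s) h
  subst hc
  rfl

end Point

end CSpace

namespace CSpace

section Construction

variable {X Y : CSpace} [Subsingleton Y.space.toTopCat]

theorem map_eq_bot (b : X.space.toTopCat ⟶ Y.space.toTopCat)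
    {U : (Opens Y.space.toTopCat)ᵒᵖ} (h : U ≠ op ⊤) : (Opens.map b).obj U.unop = ⊥ := by
  ext x
  simp only [SetLike.mem_coe, Opens.coe_bot, Set.mem_empty_iff_false, iff_false]
  intro hx
  exact h (congrArg op (opens_eq_top U.unop (y := b x) hx))

open Classical in
/-- The map of presheaves on a one-point space given by a map of global sections. -/
noncomputable def presheafHom (b : X.space.toTopCat ⟶ Y.space.toTopCat)
    (ψ : Y.space.presheaf.obj (op ⊤) ⟶ X.space.presheaf.obj (op ⊤)) :
    Y.space.presheaf ⟶ (TopCat.Presheaf.pushforward CommRingCat b).obj X.space.presheaf where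
  app U := if h : U = op ⊤ then eqToHom (by rw [h]) ≫ ψ ≫ eqToHom (by rw [h]; rfl)
    else (X.space.sheaf.isTerminalOfEqEmpty (map_eq_bot b h)).from _
  naturality U V i := by
    by_cases hV : V = op ⊤
    · subst hV
      have hU : U = op ⊤ := by
        obtain ⟨U⟩ := U
        exact congrArg op (top_le_iff.1 (leOfHom i.unop))
      subst hU
      have hi : i = 𝟙 _ := Subsingleton.elim _ _
      subst hi
      simp
    · exact (X.space.sheaf.isTerminalOfEqEmpty (map_eq_bot b hV)).hom_ext _ _

theorem presheafHom_app_top (b : X.space.toTopCat ⟶ Y.space.toTopCat)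
    (ψ : Y.space.presheaf.obj (op ⊤) ⟶ X.space.presheaf.obj (op ⊤)) :
    (presheafHom b ψ).app (op ⊤) = ψ := by
  simp [presheafHom]
  rfl

/-- A local homomorphism of the algebras of one-point spaces gives a morphism of spaces. -/
theorem exists_hom_of_pull [Subsingleton X.space.toTopCat] [Nonempty Y.space.toTopCat]
    (φ : Y.Sec →+* X.Sec)
    (hφ : ∀ s, IsUnit (φ s) → IsUnit s) (hc : ∀ c, φ (Y.constHom c) = X.constHom c) :
    ∃ f : X ⟶ Y, Hom.pull f = φ := by
  obtain ⟨y⟩ := ‹Nonempty Y.space.toTopCat›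
  let b : X.space.toTopCat ⟶ Y.space.toTopCat := TopCat.ofHom (ContinuousMap.const _ y)
  let ψ : Y.space.presheaf.obj (op ⊤) ⟶ X.space.presheaf.obj (op ⊤) := CommRingCat.ofHom φ
  let p : X.space.toPresheafedSpace ⟶ Y.space.toPresheafedSpace := ⟨b, presheafHom b ψ⟩
  have hp : p.c.app (op ⊤) = ψ := presheafHom_app_top b ψ
  let m : X.space ⟶ Y.space := ⟨p, fun x => ⟨fun a ha => by
    obtain ⟨s, rfl⟩ := (germ_bijective (Y := Y) (p.base x)).2 a
    have h1 : (PresheafedSpace.Hom.stalkMap p x).hom (Y.germ (p.base x) s) = X.germ x (φ s) := by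
      refine (PresheafedSpace.stalkMap_germ_apply p ⊤ x trivial s).trans ?_
      rw [hp]
      rfl
    rw [h1] at ha
    refine (hφ s ?_).map _
    exact (MulEquiv.isUnit_map (RingEquiv.ofBijective _ (germ_bijective (Y := X) x))).1 ha⟩⟩
  refine ⟨⟨m, ?_⟩, ?_⟩
  · rw [LocallyRingedSpace.Γ_map_op]
    ext c
    change (p.c.app (op ⊤)).hom (Y.constHom c) = X.constHom c
    rw [hp]
    exact hc c
  · exact congrArg CommRingCat.Hom.hom ((LocallyRingedSpace.Γ_map_op m).trans hp)

end Construction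
end CSpace

open SpaceGerm

/-! ### The algebra of a germ -/

namespace Germ

variable {R S T : Germ}

instance (S : Germ) : Nonempty S.sp.obj.space.toTopCat := S.nonempty

instance (S : Germ) : Subsingleton S.sp.obj.space.toTopCat := S.subsingleton

/-- The analytic algebra of a germ. -/
abbrev Alg (S : Germ) : Type := S.sp.obj.Sec

/-- The point of a germ. -/
noncomputable def point (S : Germ) : S.sp.Pt := S.nonempty.some

/-- The homomorphism of analytic algebras given by a morphism of germs. -/
noncomputable def pull (f : R.sp ⟶ S.sp) : S.Alg →+* R.Alg := CSpace.Hom.pull f.hom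

theorem pull_comp_apply (f : R.sp ⟶ S.sp) (g : S.sp ⟶ T.sp) (s : T.Alg) :
    pull (f ≫ g) s = pull f (pull g s) := rfl

theorem hom_ext {f g : R.sp ⟶ S.sp} (h : pull f = pull g) : f = g :=
  isSpaceGerm.hom_ext (CSpace.hom_ext_of_pull h)

theorem pull_constHom (f : R.sp ⟶ S.sp) (c : ℂ) :
    pull f (S.sp.obj.constHom c) = R.sp.obj.constHom c :=
  CSpace.Hom.pull_constHom f.hom c

/-- The analytic algebra of a germ is its stalk. -/
noncomputable def stalkEquiv (S : Germ) (x : S.sp.Pt) : S.Alg ≃+* S.sp.Stalk x :=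
  RingEquiv.ofBijective (S.sp.obj.germ x) (CSpace.germ_bijective (Y := S.sp.obj) x)

theorem onStalk_stalkEquiv (f : R.sp ⟶ S.sp) (x : R.sp.Pt) (s : S.Alg) :
    onStalk f x (S.stalkEquiv (onPt f x) s) = R.stalkEquiv x (pull f s) :=
  CSpace.Hom.stalkMap_germ f.hom x s

instance (S : Germ) : IsLocalRing S.Alg := (S.stalkEquiv S.point).symm.isLocalRing

instance (S : Germ) : IsNoetherianRing S.Alg := by
  have := (CSpace.stalk_of_presentation (S.sp.property S.point).some).1
  exact isNoetherianRing_of_ringEquiv _ (S.stalkEquiv S.point).symm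

theorem exists_const_sub_mem (s : S.Alg) :
    ∃ c : ℂ, s - S.sp.obj.constHom c ∈ IsLocalRing.maximalIdeal S.Alg := by
  obtain ⟨c, hc⟩ := (CSpace.stalk_of_presentation (S.sp.property S.point).some).2
    (S.stalkEquiv S.point s)
  refine ⟨c, fun hu => hc ?_⟩
  have := hu.map (S.stalkEquiv S.point)
  rwa [map_sub] at this

instance isLocalHom_pull (f : R.sp ⟶ S.sp) : IsLocalHom (pull f) where
  map_nonunit s hs := by
    have h := hs.map (R.stalkEquiv R.point)
    rw [← onStalk_stalkEquiv] at h
    exact (MulEquiv.isUnit_map (S.stalkEquiv (onPt f R.point))).1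
      (CSpace.Hom.isUnit_of_stalkMap f.hom R.point h)

theorem pull_mem_maximalIdeal (f : R.sp ⟶ S.sp) {s : S.Alg}
    (hs : s ∈ IsLocalRing.maximalIdeal S.Alg) : pull f s ∈ IsLocalRing.maximalIdeal R.Alg :=
  fun hu => hs (isUnit_of_map_unit (pull f) s hu)

theorem pull_mem_maximalIdeal_pow (f : R.sp ⟶ S.sp) (k : ℕ) {s : S.Alg}
    (hs : s ∈ IsLocalRing.maximalIdeal S.Alg ^ k) :
    pull f s ∈ IsLocalRing.maximalIdeal R.Alg ^ k := by
  have h := Ideal.mem_map_of_mem (pull f) hs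
  rw [Ideal.map_pow] at h
  refine Ideal.pow_right_mono (Ideal.map_le_iff_le_comap.2 fun t ht => ?_) k h
  exact pull_mem_maximalIdeal f ht

theorem isGermEmbedding_iff (f : R.sp ⟶ S.sp) :
    IsGermEmbedding f ↔ Function.Surjective (pull f) := by
  constructor
  · intro h a
    obtain ⟨b, hb⟩ := h R.point (R.stalkEquiv _ a)
    obtain ⟨s, rfl⟩ := (S.stalkEquiv _).surjective b
    rw [onStalk_stalkEquiv] at hb
    exact ⟨s, (R.stalkEquiv _).injective hb⟩
  · intro h x a
    obtain ⟨s, hs⟩ := h ((R.stalkEquiv x).symm a)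
    refine ⟨S.stalkEquiv _ s, ?_⟩
    rw [onStalk_stalkEquiv, hs, RingEquiv.apply_symm_apply]

/-- Embeddings of germs are monomorphisms. -/
theorem eq_of_comp_embedding {ι : S.sp ⟶ T.sp} (hι : IsGermEmbedding ι) {f g : R.sp ⟶ S.sp}
    (h : f ≫ ι = g ≫ ι) : f = g := by
  refine hom_ext (RingHom.ext fun s => ?_)
  obtain ⟨t, rfl⟩ := (isGermEmbedding_iff ι).1 hι s
  rw [← pull_comp_apply, h, pull_comp_apply]

/-- A morphism whose homomorphism of algebras kills the kernel of an embedding factors through the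
embedding. -/
theorem exists_factorization {t : T.sp ⟶ S.sp} (ht : IsGermEmbedding t) (w : R.sp ⟶ S.sp)
    (h : RingHom.ker (pull t) ≤ RingHom.ker (pull w)) : ∃ u : R.sp ⟶ T.sp, u ≫ t = w := by
  have hsurj := (isGermEmbedding_iff t).1 ht
  let φ : T.Alg →+* R.Alg := (pull t).liftOfSurjective hsurj ⟨pull w, h⟩
  have hφ : ∀ s, φ (pull t s) = pull w s := fun s =>
    (pull t).liftOfRightInverse_comp_apply _ _ ⟨pull w, h⟩ s
  obtain ⟨u, hu⟩ := CSpace.exists_hom_of_pull (X := R.sp.obj) (Y := T.sp.obj) φ (fun a ha => by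
    obtain ⟨s, rfl⟩ := hsurj a
    rw [hφ] at ha
    exact (isUnit_of_map_unit (pull w) s ha).map (pull t)) fun c => by
      rw [← pull_constHom t, hφ, pull_constHom]
  refine ⟨⟨u⟩, hom_ext (RingHom.ext fun s => ?_)⟩
  rw [← hφ, ← hu]
  rfl

theorem ker_pull_of_isTangentSpace {t : T.sp ⟶ S.sp} (ht : IsTangentSpace t) :
    RingHom.ker (pull t) = IsLocalRing.maximalIdeal S.Alg ^ 2 := by
  have h := ht.2 T.point
  set e := S.stalkEquiv (onPt t T.point)
  have hm : IsLocalRing.maximalIdeal (S.sp.Stalk (onPt t T.point)) =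
      (IsLocalRing.maximalIdeal S.Alg).map e := by
    ext a
    rw [Ideal.mem_map_of_equiv]
    constructor
    · intro ha
      exact ⟨e.symm a, fun hu => ha (by simpa using hu.map e), e.apply_symm_apply a⟩
    · rintro ⟨s, hs, rfl⟩ hu
      exact hs ((MulEquiv.isUnit_map e).1 hu)
  ext s
  have h1 : s ∈ RingHom.ker (pull t) ↔ e s ∈ RingHom.ker (onStalk t T.point) := by
    rw [RingHom.mem_ker, RingHom.mem_ker, onStalk_stalkEquiv]
    exact (map_eq_zero_iff _ (T.stalkEquiv T.point).injective).symm
  rw [h1, h, hm, ← Ideal.map_pow, Ideal.mem_map_of_equiv]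
  constructor
  · rintro ⟨s', hs', hss'⟩
    rwa [← e.injective hss']
  · exact fun hs => ⟨s, hs, rfl⟩

/-- By surjectivity, the maximal ideal of `T` comes from that of `S`, whose square is the kernel. -/
theorem isFirstOrder_of_isTangentSpace {t : T.sp ⟶ S.sp} (ht : IsTangentSpace t) :
    IsFirstOrder T := by
  intro x
  have h1 : IsLocalRing.maximalIdeal (T.sp.Stalk x) ≤
      (IsLocalRing.maximalIdeal (S.sp.Stalk (onPt t x))).map (onStalk t x) := by
    intro a ha
    obtain ⟨b, rfl⟩ := ht.1 x a
    exact Ideal.mem_map_of_mem _ fun hu => ha (hu.map _)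
  refine le_bot_iff.1 ((Ideal.pow_right_mono h1 2).trans ?_)
  rw [← Ideal.map_pow, ← ht.2 x, Ideal.map_le_iff_le_comap]
  exact fun s hs => hs

/-! ### The simple point -/

/-- The global sections of the simple point are the constants. -/
theorem exists_const_of_simplePoint (s : simplePoint.Alg) :
    ∃ c, s = simplePoint.sp.obj.constHom c := by
  change HolomorphicOn (⊤ : Opens (EuclideanSpace ℂ (Fin 0))) at s
  refine ⟨s ⟨0, trivial⟩, ?_⟩
  change s = algebraMap ℂ (HolomorphicOn ⊤) (s ⟨0, trivial⟩)
  ext z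
  rw [Subsingleton.elim z ⟨0, trivial⟩]
  rfl

theorem eq_of_to_simplePoint {X : SpaceGerm} (p q : X ⟶ simplePoint.sp) : p = q := by
  refine isSpaceGerm.hom_ext (CSpace.hom_ext_of_pull (Y := simplePoint.sp.obj) ?_)
  refine RingHom.ext fun s => ?_
  obtain ⟨c, rfl⟩ := exists_const_of_simplePoint s
  exact (CSpace.Hom.pull_constHom p.hom c).trans (CSpace.Hom.pull_constHom q.hom c).symm

theorem eq_of_from_simplePoint (p q : simplePoint.sp ⟶ S.sp) : p = q := by
  refine hom_ext (RingHom.ext fun s => ?_)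
  obtain ⟨c, hc⟩ := exists_const_of_simplePoint (pull p s)
  obtain ⟨d, hd⟩ := exists_const_of_simplePoint (pull q (s - S.sp.obj.constHom c))
  -- The element `s - c` is killed by `p`, so it is not a unit, and its value under `q` is a
  -- constant that is not a unit, namely `0`.
  have h1 : pull p (s - S.sp.obj.constHom c) = 0 := by
    rw [map_sub, pull_constHom, hc, sub_self]
  have h2 : ¬ IsUnit (pull q (s - S.sp.obj.constHom c)) := fun hu => by
    have := (isUnit_of_map_unit (pull q) _ hu).map (pull p)
    rw [h1] at this
    exact not_isUnit_zero this
  have hd0 : d = 0 := by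
    by_contra hd0
    rw [hd] at h2
    exact h2 ((isUnit_iff_ne_zero.2 hd0).map _)
  rw [hd0, map_zero, map_sub, sub_eq_zero, pull_constHom] at hd
  rw [hc, hd]

end Germ

/-! ### Endomorphisms which are the identity on the tangent space -/

/-- Two local homomorphisms to a Noetherian local ring are equal if they agree on constants and
after composition with an endomorphism which is the identity modulo the square of the maximal
ideal. -/
theorem eq_of_comp_eq_of_sub_mem_sq {A B : Type*} [CommRing A] [IsLocalRing A] [CommRing B]
    [IsLocalRing B] [IsNoetherianRing B] (φ : A →+* A)
    (hφ : ∀ a, φ a - a ∈ IsLocalRing.maximalIdeal A ^ 2) (u v : A →+* B) [IsLocalHom u]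
    [IsLocalHom v] (hc : ∀ a, ∃ c, u c = v c ∧ a - c ∈ IsLocalRing.maximalIdeal A)
    (h : ∀ a, u (φ a) = v (φ a)) : u = v := by
  have hu : ∀ a ∈ IsLocalRing.maximalIdeal A, u a ∈ IsLocalRing.maximalIdeal B :=
    fun a ha hu => ha (isUnit_of_map_unit u a hu)
  have hv : ∀ a ∈ IsLocalRing.maximalIdeal A, v a ∈ IsLocalRing.maximalIdeal B :=
    fun a ha hv => ha (isUnit_of_map_unit v a hv)
  -- As `u ∘ φ = v ∘ φ`, the difference `u - v` at `a` is, up to sign, its value at `φ a - a`, which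
  -- lies in the square of the maximal ideal; there the Leibniz rule gains one power.
  have key : ∀ k : ℕ, ∀ a, u a - v a ∈ IsLocalRing.maximalIdeal B ^ (k + 1) := by
    intro k
    induction k with
    | zero =>
      intro a
      obtain ⟨c, hc, hac⟩ := hc a
      rw [zero_add, pow_one]
      have : u a - v a = u (a - c) - v (a - c) := by rw [map_sub, map_sub, hc]; ring
      rw [this]
      exact sub_mem (hu _ hac) (hv _ hac)
    | succ k ih =>
      have hsq : ∀ y ∈ IsLocalRing.maximalIdeal A ^ 2,
          u y - v y ∈ IsLocalRing.maximalIdeal B ^ (k + 1 + 1) := by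
        intro y hy
        rw [pow_two] at hy
        induction hy using Submodule.mul_induction_on' with
        | mem_mul_mem a ha b hb =>
          have : u (a * b) - v (a * b) = u a * (u b - v b) + v b * (u a - v a) := by
            rw [map_mul, map_mul]; ring
          rw [this, pow_succ']
          exact add_mem (Ideal.mul_mem_mul (hu a ha) (ih b)) (Ideal.mul_mem_mul (hv b hb) (ih a))
        | add a _ b _ ha hb =>
          have : u (a + b) - v (a + b) = (u a - v a) + (u b - v b) := by
            rw [map_add, map_add]; ring
          rw [this]
          exact add_mem ha hb
      intro a
      have : u a - v a = -(u (φ a - a) - v (φ a - a)) := by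
        rw [map_sub, map_sub, h]; ring
      rw [this]
      exact neg_mem (hsq _ (hφ a))
  ext a
  have hmem : u a - v a ∈ ⨅ k : ℕ, IsLocalRing.maximalIdeal B ^ k := by
    rw [Ideal.mem_iInf]
    exact fun k => Ideal.pow_le_pow_right (Nat.le_succ k) (key k a)
  rw [Ideal.iInf_pow_eq_bot_of_isLocalRing _ (IsLocalRing.maximalIdeal.isMaximal B).ne_top] at hmem
  exact sub_eq_zero.1 hmem

theorem Germ.eq_of_comp_eq {R S : Germ} {φ : S.sp ⟶ S.sp}
    (hφ : ∀ s, Germ.pull φ s - s ∈ IsLocalRing.maximalIdeal S.Alg ^ 2) {g k : R.sp ⟶ S.sp}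
    (h : g ≫ φ = k ≫ φ) : g = k := by
  refine Germ.hom_ext (eq_of_comp_eq_of_sub_mem_sq (Germ.pull φ) hφ _ _ (fun s => ?_) fun s => ?_)
  · obtain ⟨c, hc⟩ := Germ.exists_const_sub_mem s
    exact ⟨_, (Germ.pull_constHom g c).trans (Germ.pull_constHom k c).symm, hc⟩
  · rw [← Germ.pull_comp_apply, h, Germ.pull_comp_apply]

/-! ### Induced deformations -/

section Induced

variable {X : SpaceGerm} {Q R S T : Germ}

theorem IsInduced.comp {F : Deformation X S} {G : Deformation X R} {H : Deformation X Q}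
    {h : R.sp ⟶ S.sp} {k : Q.sp ⟶ R.sp} (hG : IsInduced F h G) (hH : IsInduced G k H) :
    IsInduced F (k ≫ h) H := by
  obtain ⟨p, hp, hpi⟩ := hG
  obtain ⟨q, hq, hqi⟩ := hH
  exact ⟨q ≫ p, hq.paste_horiz hp, by rw [← Category.assoc, hqi, hpi]⟩

/-- The special fibres of two deformations are mapped in the same way to any germ. -/
theorem Deformation.i_comp_f_comp (F : Deformation X S) (G : Deformation X R)
    (h : S.sp ⟶ T.sp) (k : R.sp ⟶ T.sp) : F.i ≫ F.f ≫ h = G.i ≫ G.f ≫ k := by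
  obtain ⟨q, p, hF⟩ := F.isFiber
  obtain ⟨q', p', hG⟩ := G.isFiber
  rw [← Category.assoc, hF.w, ← Category.assoc, hG.w, Category.assoc, Category.assoc,
    Germ.eq_of_to_simplePoint q q', Germ.eq_of_from_simplePoint (p ≫ h) (p' ≫ k)]

/-- Cancellation of cartesian squares, together with compatibility with the embeddings of `X`. -/
theorem IsInduced.cancel {F : Deformation X S} {G : Deformation X R} {H : Deformation X Q}
    {h : R.sp ⟶ S.sp} {k : Q.sp ⟶ R.sp} (hG : IsInduced F h G) (hH : IsInduced F (k ≫ h) H) :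
    IsInduced G k H := by
  obtain ⟨p, hp, hpi⟩ := hG
  obtain ⟨q, hq, hqi⟩ := hH
  have hw : q ≫ F.f = (H.f ≫ k) ≫ h := by rw [hq.w, Category.assoc]
  refine ⟨hp.lift q (H.f ≫ k) hw, ?_, ?_⟩
  · refine IsPullback.of_right (h₁₂ := p) (h₂₂ := h) (v₁₃ := F.f) ?_ (hp.lift_snd _ _ _) hp
    rwa [hp.lift_fst]
  · refine hp.hom_ext ?_ ?_
    · rw [Category.assoc, hp.lift_fst, hqi, hpi]
    · rw [Category.assoc, hp.lift_snd]
      -- On the special fibre both maps to the base factor through the simple point, hence agree.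
      simpa using H.i_comp_f_comp G k (𝟙 _)

/-- A morphism which induces a miniversal deformation from itself is a monomorphism. -/
theorem IsMiniversal.eq_of_comp_eq {F : Deformation X S} (hF : IsMiniversal F) {φ : S.sp ⟶ S.sp}
    (hφ : IsInduced F φ F) {g k : R.sp ⟶ S.sp} (h : g ≫ φ = k ≫ φ) : g = k := by
  obtain ⟨-, T, TX, t, δ, K, ht, hδ, ⟨FT, htFT, hKFT⟩, hK⟩ := hF
  have hker := Germ.ker_pull_of_isTangentSpace ht
  obtain ⟨ψ, hψ⟩ : ∃ ψ : T.sp ⟶ T.sp, ψ ≫ t = t ≫ φ := by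
    refine Germ.exists_factorization ht.1 _ ?_
    intro s hs
    rw [hker] at hs
    rw [RingHom.mem_ker, Germ.pull_comp_apply, ← RingHom.mem_ker, hker]
    exact Germ.pull_mem_maximalIdeal_pow φ 2 hs
  have h1 : IsInduced FT ψ FT := htFT.cancel (by rw [hψ]; exact hφ.comp htFT)
  -- Both sides induce `FT` from the universal deformation; as `K` is a monomorphism, `ψ` is the
  -- identity.
  have h2 : ψ ≫ K = K := (hδ.2 T (Germ.isFirstOrder_of_isTangentSpace ht) FT).unique
    (hKFT.comp h1) hKFT
  have h3 : t ≫ φ = t := by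
    rw [← hψ, Germ.eq_of_comp_embedding hK (h2.trans (Category.id_comp K).symm), Category.id_comp]
  refine Germ.eq_of_comp_eq (fun s => ?_) h
  rw [← hker, RingHom.mem_ker, map_sub, ← Germ.pull_comp_apply, h3, sub_self]

/-- The modular stratum of a miniversal deformation is contained, by way of a morphism of the bases
which induces the deformation, in the modular stratum of any other one. -/
theorem exists_map_of_modular {S' M M' : Germ} {f : Deformation X S} {f' : Deformation X S'}
    (hf' : IsMiniversal f') {a : S.sp ⟶ S'.sp} {b : S'.sp ⟶ S.sp} (ha : IsInduced f' a f)
    (hb : IsInduced f b f') {ι : M.sp ⟶ S.sp} {ι' : M'.sp ⟶ S'.sp} (hι : IsModular f ι)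
    (hι' : IsMaximalModular f' ι') {fM : Deformation X M} (hfM : IsInduced f ι fM) :
    ι ≫ a ≫ b = ι ∧ ∃ u : M.sp ⟶ M'.sp, u ≫ ι' = ι ≫ a := by
  have hab : ι ≫ a ≫ b = ι := by
    have h := hι.2 M (𝟙 _) (ι ≫ a ≫ b) fM (by rwa [Category.id_comp])
      ((hb.comp ha).comp hfM)
    rw [← h, Category.id_comp]
  refine ⟨hab, hι'.2 M (ι ≫ a) ⟨?_, fun R h g G hG hG' => ?_⟩⟩
  · rw [Germ.isGermEmbedding_iff]
    intro s
    obtain ⟨r, rfl⟩ := (Germ.isGermEmbedding_iff ι).1 hι.1 s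
    -- Since `ι ≫ a ≫ b = ι`, preimages under `ι` can be pulled back along `b`.
    exact ⟨Germ.pull b r, by
      rw [← Germ.pull_comp_apply, Category.assoc, hab]⟩
  · have h1 : IsInduced f (h ≫ ι) G := by
      have := hb.comp hG
      rwa [Category.assoc, Category.assoc, hab] at this
    have h2 : h ≫ ι = g ≫ b := hι.2 R h (g ≫ b) G h1 (hb.comp hG')
    -- The two morphisms to `S'` agree after `b`, hence after `b ≫ a`, which can be cancelled
    -- because it induces `f'` from itself.
    refine hf'.eq_of_comp_eq (ha.comp hb) ?_
    rw [← Category.assoc g, ← h2]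
    simp only [Category.assoc]
    rw [reassoc_of% hab]

end Induced

/-! ### The isomorphism of maximal modular strata -/

theorem propositionp2 (X : SpaceGerm) (hX : IsComplexSpace X.obj)
    {S S' : Germ} (f : Deformation X S) (f' : Deformation X S')
    (hf : IsMiniversal f) (hf' : IsMiniversal f')
    {M M' : Germ} (ι : M.sp ⟶ S.sp) (ι' : M'.sp ⟶ S'.sp)
    (hM : IsMaximalModular f ι) (hM' : IsMaximalModular f' ι')
    (fM : Deformation X M) (hfM : IsInduced f ι fM)
    (fM' : Deformation X M') (hfM' : IsInduced f' ι' fM') :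
    ∃ h : M'.sp ≅ M.sp, IsInduced fM h.hom fM' ∧
      ∀ k : M'.sp ⟶ M.sp, IsInduced fM k fM' → k = h.hom := by
  obtain ⟨a, ha⟩ := hf'.1 S f
  obtain ⟨b, hb⟩ := hf.1 S' f'
  obtain ⟨hab, u, hu⟩ := exists_map_of_modular hf' ha hb hM.1 hM' hfM
  obtain ⟨hba, v, hv⟩ := exists_map_of_modular hf hb ha hM'.1 hM hfM'
  have hind : IsInduced f (v ≫ ι) fM' := by
    rw [hv]
    exact hb.comp hfM'
  refine ⟨⟨v, u, ?_, ?_⟩, hfM.cancel hind, fun k hk => ?_⟩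
  · refine Germ.eq_of_comp_embedding hM'.1.1 ?_
    rw [Category.assoc, hu, Category.id_comp, ← Category.assoc, hv, Category.assoc, hba]
  · refine Germ.eq_of_comp_embedding hM.1.1 ?_
    rw [Category.assoc, hv, Category.id_comp, ← Category.assoc, hu, Category.assoc, hab]
  -- After `ι`, both `k` and `v` induce `fM'` from `f`, so modularity of `M` identifies them.
  · exact Germ.eq_of_comp_embedding hM.1.1 (hM.1.2 M' k (v ≫ ι) fM' (hfM.comp hk) hind)
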